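/- Let $x:\mathbb{R}^p\to\mathbb{C}^n$ have partial derivatives at $\theta\in\mathbb{R}^p$, and let $G\in\mathbb{C}^{n\times p}$ be the matrix with columns $g_i=\partial x/\partial\theta_i$ at $\theta$. Let $\sigma>0$. The Fisher information matrix of the model $\mathcal{CN}(x(\theta),\sigma^2 I_n)$ is taken to be the Gramian $J=\frac{1}{\sigma^2}G^HG$, and $J$ is assumed invertible. For a compression matrix $\Phi\in\mathbb{C}^{m\times n}$ put $P_{\Phi^H}=\Phi^H(\Phi\Phi^H)^{-1}\Phi$ and $\hat G=P_{\Phi^H}G$; the Fisher information matrix after compression is $\hat J=\frac{1}{\sigma^2}\hat G^H\hat G$. The inverses $J^{-1}$ and $\hat J^{-1}$ are the Cramér–Rao bound (CRB) matrices before and after compression. Suppose $m+p\le n$ and let $\Phi$ be random, of one of the following kinds: (a) its entries are i.i.d. $\mathcal{CN}(0,1)$; (b) it has a density of the form $g(\Phi\Phi^H)$ with respect to Lebesgue measure on $\mathbb{C}^{m\times n}$; (c) its distribution is invariant under $\Phi\mapsto\Phi U$ for every unitary $U\in\mathbb{C}^{n\times n}$, and $\Phi$ almost surely has rank $m$. Then: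 1. $\hat J$ is (entrywise) integrable and $$E[\hat J]=\frac{m}{n}\,J,\qquad\text{so that}\qquad J-E[\hat J]=\frac{n-m}{n}\,J;$$ that is, on average, compression loses a fraction $\frac{n-m}{n}$ of the Fisher information. 2. If moreover $p<m$, then $\hat J$ is almost surely invertible, $\hat J^{-1}$ is (entrywise) integrable, and $$E[\hat J^{-1}]=\frac{n-p}{m-p}\,J^{-1};$$ that is, on average, compression inflates the CRB matrix by the factor $\frac{n-p}{m-p}$. -/

import Mathlib

open MeasureTheory ProbabilityTheory Matrix

noncomputable section

namespace CompressedFisher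

/-- The Jacobian `G = [g_1, …, g_p]` of the mean vector `x` at `θ`: its `j`-th column is the
partial derivative of `x` with respect to the real parameter `θ_j`. -/
def jacobian {n p : ℕ} (x : (Fin p → ℝ) → (Fin n → ℂ)) (θ : Fin p → ℝ) :
    Matrix (Fin n) (Fin p) ℂ :=
  Matrix.of fun i j => lineDeriv ℝ x θ (Pi.single j 1) i

/-- The Fisher information matrix `J(θ) = σ⁻² Gᴴ G` of the model `CN(x(θ), σ² I)`. -/
def fisherInfo {n p : ℕ} (σ : ℝ) (x : (Fin p → ℝ) → (Fin n → ℂ)) (θ : Fin p → ℝ) :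
    Matrix (Fin p) (Fin p) ℂ :=
  ((1 : ℂ) / (σ : ℂ) ^ 2) • ((jacobian x θ)ᴴ * jacobian x θ)

/-- The projection `P_{Φᴴ} = Φᴴ (Φ Φᴴ)⁻¹ Φ` (the orthogonal projection determined by the rows of a
matrix `Φ` of full row rank). -/
def rowProjection {m n : ℕ} (Φ : Matrix (Fin m) (Fin n) ℂ) : Matrix (Fin n) (Fin n) ℂ :=
  Φᴴ * (Φ * Φᴴ)⁻¹ * Φ

/-- The Fisher information matrix after compression by `Φ`:
`Ĵ(θ) = σ⁻² Ĝᴴ Ĝ` with `Ĝ = P_{Φᴴ} G`. -/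
def compressedFisherInfo {m n p : ℕ} (σ : ℝ) (x : (Fin p → ℝ) → (Fin n → ℂ)) (θ : Fin p → ℝ)
    (Φ : Matrix (Fin m) (Fin n) ℂ) : Matrix (Fin p) (Fin p) ℂ :=
  ((1 : ℂ) / (σ : ℂ) ^ 2) •
    ((rowProjection Φ * jacobian x θ)ᴴ * (rowProjection Φ * jacobian x θ))

/-- The standard proper complex normal distribution `CN(0, 1)`, with density `π⁻¹ exp(-|z|²)`. -/
def stdComplexNormal : Measure ℂ :=
  volume.withDensity fun z => ENNReal.ofReal (Real.pi⁻¹ * Real.exp (-‖z‖ ^ 2))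

variable {Ω : Type*} [MeasurableSpace Ω]

/-- The entries of the random matrix `Φ` are i.i.d. with law `CN(0, 1)`. -/
def IsIIDStdComplexNormal {m n : ℕ} (Φ : Ω → Matrix (Fin m) (Fin n) ℂ) (P : Measure Ω) : Prop :=
  (∀ i j, HasLaw (fun ω => Φ ω i j) stdComplexNormal P) ∧
    iIndepFun (fun (ij : Fin m × Fin n) (ω : Ω) => Φ ω ij.1 ij.2) P

/-- The random matrix `Φ` has, with respect to Lebesgue measure on the space of complex
`m × n` matrices, a density of the form `g(Φ Φᴴ)`. -/
def HasGramDensity {m n : ℕ} (Φ : Ω → Matrix (Fin m) (Fin n) ℂ) (P : Measure Ω) : Prop :=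
  ∃ g : Matrix (Fin m) (Fin m) ℂ → ENNReal,
    Measurable (fun M : Fin m → Fin n → ℂ => g (Matrix.of M * (Matrix.of M)ᴴ)) ∧
    HasLaw (fun ω (i : Fin m) (j : Fin n) => Φ ω i j)
      (volume.withDensity fun M : Fin m → Fin n → ℂ => g (Matrix.of M * (Matrix.of M)ᴴ)) P

/-- The distribution of the random matrix `Φ` is invariant under right multiplication by
every unitary matrix. -/
def IsRightUnitarilyInvariant {m n : ℕ} (Φ : Ω → Matrix (Fin m) (Fin n) ℂ) (P : Measure Ω) :
    Prop :=
  ∀ U ∈ Matrix.unitaryGroup (Fin n) ℂ,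
    IdentDistrib (fun ω (i : Fin m) (j : Fin n) => (Φ ω * U) i j)
      (fun ω (i : Fin m) (j : Fin n) => Φ ω i j) P P

/-- The random compression matrices under consideration: i.i.d. `CN(0, 1)` entries, or a density
of the form `g(Φ Φᴴ)`, or any right-unitarily invariant distribution with `Φ` almost surely of full
row rank (so that `(Φ Φᴴ)⁻¹` exists). -/
def IsRandomCompressor {m n : ℕ} (Φ : Ω → Matrix (Fin m) (Fin n) ℂ) (P : Measure Ω) : Prop :=
  IsIIDStdComplexNormal Φ P ∨ HasGramDensity Φ P ∨
    (IsRightUnitarilyInvariant Φ P ∧ ∀ᵐ ω ∂P, (Φ ω).rank = m)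

/-- All entries of the random matrix `A` are integrable, and its entrywise expectation is `B`. -/
def HasMatrixExpectation {k l : ℕ} (A : Ω → Matrix (Fin k) (Fin l) ℂ) (P : Measure Ω)
    (B : Matrix (Fin k) (Fin l) ℂ) : Prop :=
  ∀ i j, Integrable (fun ω => A ω i j) P ∧ ∫ ω, A ω i j ∂P = B i j

/-- The entrywise expectation of a random matrix. -/
def matrixExpectation {k l : ℕ} (A : Ω → Matrix (Fin k) (Fin l) ℂ) (P : Measure Ω) :
    Matrix (Fin k) (Fin l) ℂ :=
  Matrix.of fun i j => ∫ ω, A ω i j ∂P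

end CompressedFisher

end

namespace CompressedFisher

open scoped ComplexOrder

/-! All three kinds of compressor induce a law on matrices that is invariant under right
multiplication by unitaries and charges only full row rank (`IsInvariantFullRankLaw`). Then `Q =
rowProjection Φ` is almost surely a projection of trace `m`, with law invariant under unitary
conjugation. By polarization both expectations reduce to those of nonnegative quadratic forms,
computed as integrals in `ENNReal`, so that integrability comes out with the value.

For the mean information, invariance makes `E[gᴴ Q g]` equal to `‖g‖² E[Q i i]` for every `i`;
summing over `i` gives the trace, hence the factor `m / n`.

For the mean CRB, a unitary change of parameters reduces to the `(0, 0)` entry of `(Gᴴ Q G)⁻¹`. With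
`H` the other columns and `g` the first one, this entry is the reciprocal of the Schur complement
`gᴴ R g`, where `R = residualProjection Q H` is a projection of trace `m - q`. Put `T =
residualProjection 1 H`, of trace `n - q`. Unitaries fixing `H` show that `E[1 / zᴴ R z]` is a
constant `C` times `1 / zᴴ T z`. Averaging over a Gaussian `z` identifies `C`: the mean of `1 / zᴴ A
z` is `1 / (k - 1)` for a projection `A` of trace `k ≥ 2`, so `C = (n - q - 1) / (m - q - 1)`, which
is `(n - p) / (m - p)` for `p = q + 1`. No Wishart or beta distribution is needed. -/

/-! ### Complex Gaussian vectors and their unitary invariance. -/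

theorem lintegral_fin_prod_eq_prod {n : ℕ} {α : Type*} [MeasurableSpace α]
    (μ : Fin n → Measure α) [∀ i, SigmaFinite (μ i)] (f : Fin n → α → ENNReal)
    (hf : ∀ i, Measurable (f i)) :
    ∫⁻ z, ∏ i, f i (z i) ∂Measure.pi μ = ∏ i, ∫⁻ w, f i w ∂μ i := by
  induction n with
  | zero => simp
  | succ n ih =>
    have h := (measurePreserving_piFinSuccAbove μ 0).symm
    rw [← h.lintegral_comp (by fun_prop)]
    simp_rw [MeasurableEquiv.piFinSuccAbove_symm_apply, Fin.insertNthEquiv,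
      Fin.prod_univ_succ, Equiv.coe_fn_mk, Fin.insertNth_zero, Fin.cons_zero, Fin.cons_succ,
      cast_eq]
    rw [lintegral_prod_mul (μ := μ 0) (ν := Measure.pi fun j => μ (Fin.succAbove 0 j)) (f := f 0)
      (g := fun y : Fin n → α => ∏ i, f i.succ (y i)) (hf 0).aemeasurable
      (Finset.measurable_fun_prod _ fun i _ => (hf _).comp (measurable_pi_apply i)).aemeasurable]
    congr 1
    exact ih (fun i => μ i.succ) (fun i => f i.succ) (fun i => hf _)

theorem lintegral_exp_neg_mul_norm_sq {b : ℝ} (hb : 0 < b) :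
    ∫⁻ w : ℂ, ENNReal.ofReal (Real.exp (-b * ‖w‖ ^ 2)) = ENNReal.ofReal (Real.pi / b) := by
  have h := GaussianFourier.integral_rexp_neg_mul_sq_norm (V := ℂ) hb
  simp only [Complex.finrank_real_complex] at h
  norm_num at h
  have hint : Integrable (fun w : ℂ => Real.exp (-b * ‖w‖ ^ 2)) := by
    -- A non-integrable function has Bochner integral `0`, but the value in `h` is positive.
    by_contra hc
    have := integral_undef hc
    simp only [neg_mul] at this
    rw [this] at h
    have : 0 < Real.pi / b := by positivity
    linarith
  rw [← ofReal_integral_eq_lintegral_ofReal hint (.of_forall fun _ => (Real.exp_pos _).le)]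
  simp [h]

theorem lintegral_exp_neg_mul_stdComplexNormal {t : ℝ} (ht : 0 ≤ t) :
    ∫⁻ w : ℂ, ENNReal.ofReal (Real.exp (-(t * ‖w‖ ^ 2))) ∂stdComplexNormal =
      ENNReal.ofReal (1 / (1 + t)) := by
  rw [stdComplexNormal, lintegral_withDensity_eq_lintegral_mul _ (by fun_prop) (by fun_prop)]
  have : ∀ w : ℂ, ((fun z : ℂ => ENNReal.ofReal (Real.pi⁻¹ * Real.exp (-‖z‖ ^ 2))) *
      fun w : ℂ => ENNReal.ofReal (Real.exp (-(t * ‖w‖ ^ 2)))) w =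
      ENNReal.ofReal Real.pi⁻¹ * ENNReal.ofReal (Real.exp (-(1 + t) * ‖w‖ ^ 2)) := by
    intro w
    rw [Pi.mul_apply, ← ENNReal.ofReal_mul (by positivity), ← ENNReal.ofReal_mul (by positivity),
      mul_assoc, ← Real.exp_add]
    ring_nf
  simp_rw [this]
  rw [lintegral_const_mul _ (by fun_prop), lintegral_exp_neg_mul_norm_sq (by positivity),
    ← ENNReal.ofReal_mul (by positivity)]
  congr 1
  field_simp

instance : IsProbabilityMeasure stdComplexNormal := ⟨by
  simpa using lintegral_exp_neg_mul_stdComplexNormal le_rfl⟩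

/-- The law of a vector with i.i.d. `CN(0, 1)` entries. -/
noncomputable def stdComplexNormalVec (n : ℕ) : Measure (Fin n → ℂ) :=
  Measure.pi fun _ => stdComplexNormal

instance (n : ℕ) : IsProbabilityMeasure (stdComplexNormalVec n) := by
  unfold stdComplexNormalVec; infer_instance

theorem stdComplexNormalVec_eq_withDensity (n : ℕ) :
    stdComplexNormalVec n = volume.withDensity fun z : Fin n → ℂ =>
      ENNReal.ofReal (Real.pi⁻¹ ^ n * Real.exp (-(star z ⬝ᵥ z).re)) := by
  refine Measure.pi_eq fun s hs => ?_
  have hd : ∀ z : Fin n → ℂ, ENNReal.ofReal (Real.pi⁻¹ ^ n * Real.exp (-(star z ⬝ᵥ z).re)) =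
      ∏ i, ENNReal.ofReal (Real.pi⁻¹ * Real.exp (-‖z i‖ ^ 2)) := by
    intro z
    rw [← ENNReal.ofReal_prod_of_nonneg (fun _ _ => by positivity), Finset.prod_mul_distrib,
      ← Real.exp_sum]
    simp only [Finset.prod_const, Finset.card_univ, Fintype.card_fin, Finset.sum_neg_distrib]
    simp [dotProduct, ← Complex.normSq_eq_norm_sq, Complex.normSq_apply, -neg_add_rev,
      -Finset.sum_neg_distrib]
  rw [withDensity_apply _ (MeasurableSet.univ_pi hs),
    ← lintegral_indicator (MeasurableSet.univ_pi hs)]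
  have hi : ∀ z : Fin n → ℂ, (Set.univ.pi s).indicator (fun z : Fin n → ℂ =>
      ENNReal.ofReal (Real.pi⁻¹ ^ n * Real.exp (-(star z ⬝ᵥ z).re))) z =
      ∏ i, (s i).indicator (fun w : ℂ => ENNReal.ofReal (Real.pi⁻¹ * Real.exp (-‖w‖ ^ 2)))
        (z i) := by
    intro z
    by_cases hz : z ∈ Set.univ.pi s
    · rw [Set.indicator_of_mem hz, hd]
      exact Finset.prod_congr rfl fun i _ => by
        rw [Set.indicator_of_mem (hz i trivial)]
    · rw [Set.indicator_of_notMem hz]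
      simp only [Set.mem_univ_pi, not_forall] at hz
      obtain ⟨i, hi⟩ := hz
      exact (Finset.prod_eq_zero (Finset.mem_univ i) (Set.indicator_of_notMem hi _)).symm
  simp_rw [hi]
  rw [volume_pi, lintegral_fin_prod_eq_prod _ _ fun i => Measurable.indicator (by fun_prop) (hs i)]
  refine Finset.prod_congr rfl fun i _ => ?_
  rw [lintegral_indicator (hs i), stdComplexNormal, withDensity_apply _ (hs i)]

theorem star_mulVec_dotProduct_mulVec {n : ℕ} {U : Matrix (Fin n) (Fin n) ℂ}
    (hU : Uᴴ * U = 1) (a b : Fin n → ℂ) : star (U *ᵥ a) ⬝ᵥ (U *ᵥ b) = star a ⬝ᵥ b := by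
  rw [star_mulVec, dotProduct_mulVec, vecMul_vecMul, hU, vecMul_one]

theorem measurePreserving_mulVec_volume {n : ℕ} {U : Matrix (Fin n) (Fin n) ℂ}
    (hU : Uᴴ * U = 1) : MeasurePreserving (fun z : Fin n → ℂ => U *ᵥ z) volume volume := by
  -- The real determinant of a complex-linear map is the squared modulus of its complex determinant.
  have hdet : (LinearMap.restrictScalars ℝ (Matrix.toLin' U)).det = 1 := by
    rw [LinearMap.det_restrictScalars, LinearMap.det_toLin', Algebra.norm_complex_apply]
    have := congrArg Matrix.det hU
    rw [det_mul, det_conjTranspose, det_one] at this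
    have h2 : ((Complex.normSq U.det : ℝ) : ℂ) = 1 := by
      rw [Complex.normSq_eq_conj_mul_self]; exact this
    exact_mod_cast h2
  refine ⟨by fun_prop, ?_⟩
  have := Measure.map_linearMap_addHaar_eq_smul_addHaar (μ := (volume : Measure (Fin n → ℂ)))
    (f := LinearMap.restrictScalars ℝ (Matrix.toLin' U)) (by rw [hdet]; exact one_ne_zero)
  rw [hdet, inv_one, abs_one, ENNReal.ofReal_one, one_smul] at this
  exact this

theorem MeasurePreserving.withDensity_of_comp_eq {α : Type*} [MeasurableSpace α] {μ : Measure α}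
    {T : α → α} (hT : MeasurePreserving T μ μ) {f : α → ENNReal} (hf : Measurable f)
    (h : ∀ a, f (T a) = f a) :
    MeasurePreserving T (μ.withDensity f) (μ.withDensity f) := by
  refine ⟨hT.measurable, Measure.ext fun s hs => ?_⟩
  rw [Measure.map_apply hT.measurable hs, withDensity_apply _ hs,
    withDensity_apply _ (hT.measurable hs), ← hT.setLIntegral_comp_preimage hs hf]
  simp_rw [h]

theorem measurePreserving_mulVec_stdComplexNormalVec {n : ℕ} {U : Matrix (Fin n) (Fin n) ℂ}
    (hU : Uᴴ * U = 1) : MeasurePreserving (fun z : Fin n → ℂ => U *ᵥ z)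
      (stdComplexNormalVec n) (stdComplexNormalVec n) := by
  rw [stdComplexNormalVec_eq_withDensity]
  refine MeasurePreserving.withDensity_of_comp_eq (measurePreserving_mulVec_volume hU) ?_ ?_
  · simp only [dotProduct]; fun_prop
  · intro z; rw [star_mulVec_dotProduct_mulVec hU]

/-! ### Gaussian mean of the reciprocal of a projection's quadratic form. -/

/-- Turns a reciprocal into a Laplace transform, ready for Tonelli. At `q = 0` both sides are `⊤`,
so no positivity has to be known in advance. -/
theorem inv_ofReal_eq_lintegral_exp {q : ℝ} (hq : 0 ≤ q) :
    (ENNReal.ofReal q)⁻¹ = ∫⁻ t in Set.Ioi (0 : ℝ), ENNReal.ofReal (Real.exp (-(t * q))) := by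
  rcases hq.eq_or_lt with rfl | hq
  · simp
  · have h1 := integrableOn_exp_mul_Ioi (a := -q) (by linarith) 0
    have h2 := integral_exp_mul_Ioi (a := -q) (by linarith) 0
    rw [← ENNReal.ofReal_inv_of_pos hq]
    have : ∀ t : ℝ, -(t * q) = -q * t := fun t => by ring
    simp_rw [this]
    rw [← ofReal_integral_eq_lintegral_ofReal h1 (.of_forall fun _ => (Real.exp_pos _).le), h2]
    congr 1
    simp [div_eq_mul_inv]

theorem lintegral_one_add_inv_pow {k : ℕ} (hk : 2 ≤ k) :
    ∫⁻ t in Set.Ioi (0 : ℝ), ENNReal.ofReal ((1 / (1 + t)) ^ k) = ENNReal.ofReal (1 / (k - 1)) := by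
  obtain ⟨j, rfl⟩ : ∃ j, k = j + 2 := ⟨k - 2, by omega⟩
  set g : ℝ → ℝ := fun t => -(1 / (j + 1)) * (1 / (1 + t)) ^ (j + 1) with hg
  have hderiv : ∀ t ∈ Set.Ici (0 : ℝ), HasDerivAt g ((1 / (1 + t)) ^ (j + 2)) t := by
    intro t ht
    have ht' : (1 : ℝ) + t ≠ 0 := by have : 0 ≤ t := ht; positivity
    have h1 : HasDerivAt (fun t : ℝ => 1 / (1 + t)) (-1 / (1 + t) ^ 2) t := by
      simp only [one_div]
      exact ((hasDerivAt_id t).const_add 1).fun_inv ht'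
    convert! ((h1.pow (j + 1)).const_mul (-(1 / ((j : ℝ) + 1)))) using 1
    have : (j : ℝ) + 1 ≠ 0 := by positivity
    push_cast
    field_simp
    simp only [one_div, inv_pow]
    rw [pow_add _ j 2]
    field_simp
  have hlim : Filter.Tendsto g Filter.atTop (nhds 0) := by
    have h1 : Filter.Tendsto (fun t : ℝ => 1 / (1 + t)) Filter.atTop (nhds 0) := by
      simp only [one_div]
      exact tendsto_inv_atTop_zero.comp (Filter.tendsto_atTop_add_const_left _ _ Filter.tendsto_id)
    simpa [hg] using (h1.pow (j + 1)).const_mul (-(1 / ((j : ℝ) + 1)))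
  have hpos : ∀ t ∈ Set.Ioi (0 : ℝ), 0 ≤ (1 / (1 + t)) ^ (j + 2) := by
    intro t ht; have : 0 < t := ht; positivity
  have hint := integrableOn_Ioi_deriv_of_nonneg' hderiv hpos hlim
  have hval := integral_Ioi_of_hasDerivAt_of_nonneg' hderiv hpos hlim
  rw [← ofReal_integral_eq_lintegral_ofReal hint
    ((ae_restrict_iff' measurableSet_Ioi).2 (.of_forall hpos)), hval]
  congr 1
  simp [hg]
  ring

/-- The real part of the sesquilinear form `zᴴ A z`. -/
noncomputable def quadForm {n : ℕ} (A : Matrix (Fin n) (Fin n) ℂ) (z : Fin n → ℂ) : ℝ :=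
  (star z ⬝ᵥ A *ᵥ z).re

theorem star_dotProduct_self_nonneg {n : ℕ} (z : Fin n → ℂ) : 0 ≤ (star z ⬝ᵥ z).re := by
  exact (Complex.le_def.1 (dotProduct_star_self_nonneg z)).1

theorem star_dotProduct_self_im {n : ℕ} (z : Fin n → ℂ) : (star z ⬝ᵥ z).im = 0 :=
  ((Complex.le_def.1 (dotProduct_star_self_nonneg z)).2).symm

theorem star_dotProduct_mulVec_of_isStarProjection {n : ℕ} {A : Matrix (Fin n) (Fin n) ℂ}
    (hA : IsStarProjection A) (x y : Fin n → ℂ) :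
    star x ⬝ᵥ A *ᵥ y = star (A *ᵥ x) ⬝ᵥ A *ᵥ y := by
  have h1 : Aᴴ = A := hA.isSelfAdjoint
  have h2 : A * A = A := hA.isIdempotentElem
  rw [star_mulVec, dotProduct_mulVec (star x ᵥ* Aᴴ), vecMul_vecMul, h1, h2, ← dotProduct_mulVec]

theorem quadForm_eq_of_isStarProjection {n : ℕ} {A : Matrix (Fin n) (Fin n) ℂ}
    (hA : IsStarProjection A) (z : Fin n → ℂ) :
    quadForm A z = (star (A *ᵥ z) ⬝ᵥ (A *ᵥ z)).re := by
  rw [quadForm, star_dotProduct_mulVec_of_isStarProjection hA]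

theorem quadForm_nonneg {n : ℕ} {A : Matrix (Fin n) (Fin n) ℂ}
    (hA : IsStarProjection A) (z : Fin n → ℂ) : 0 ≤ quadForm A z := by
  rw [quadForm_eq_of_isStarProjection hA]; exact star_dotProduct_self_nonneg _

theorem coe_quadForm {n : ℕ} {A : Matrix (Fin n) (Fin n) ℂ}
    (hA : IsStarProjection A) (z : Fin n → ℂ) : (quadForm A z : ℂ) = star z ⬝ᵥ A *ᵥ z := by
  apply Complex.ext
  · simp [quadForm]
  · rw [star_dotProduct_mulVec_of_isStarProjection hA, star_dotProduct_self_im]; simp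

theorem quadForm_conjTranspose_mul_mul {n k : ℕ} (A : Matrix (Fin n) (Fin n) ℂ)
    (U : Matrix (Fin n) (Fin k) ℂ) (z : Fin k → ℂ) : quadForm (Uᴴ * A * U) z = quadForm A (U *ᵥ z) := by
  simp only [quadForm, star_mulVec, ← mulVec_mulVec, dotProduct_mulVec, vecMul_vecMul]

theorem measurable_quadForm {n : ℕ} (A : Matrix (Fin n) (Fin n) ℂ) :
    Measurable (quadForm A) := by
  unfold quadForm
  simp only [dotProduct, mulVec]
  fun_prop

theorem IsStarProjection.exists_unitary_diagonal {n : ℕ} {A : Matrix (Fin n) (Fin n) ℂ}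
    (hA : IsStarProjection A) : ∃ U : Matrix (Fin n) (Fin n) ℂ, Uᴴ * U = 1 ∧
      ∃ s : Finset (Fin n), Uᴴ * A * U = diagonal (fun i => if i ∈ s then 1 else 0) ∧
        A.trace = s.card := by
  have hH : A.IsHermitian := hA.isSelfAdjoint
  set U : Matrix (Fin n) (Fin n) ℂ := ↑hH.eigenvectorUnitary with hUdef
  have hU : Uᴴ * U = 1 := Unitary.coe_star_mul_self hH.eigenvectorUnitary
  have hU' : U * Uᴴ = 1 := Unitary.coe_mul_star_self hH.eigenvectorUnitary
  have hd : Uᴴ * A * U = diagonal (RCLike.ofReal ∘ hH.eigenvalues) := by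
    have := hH.conjStarAlgAut_star_eigenvectorUnitary
    rw [Unitary.conjStarAlgAut_star_apply] at this
    exact this
  have hsq : ∀ i, hH.eigenvalues i = 0 ∨ hH.eigenvalues i = 1 := by
    intro i
    have h2 : (Uᴴ * A * U) * (Uᴴ * A * U) = Uᴴ * A * U := by
      calc _ = Uᴴ * A * (U * Uᴴ) * A * U := by simp only [Matrix.mul_assoc]
        _ = Uᴴ * (A * A) * U := by rw [hU', Matrix.mul_one]; simp only [Matrix.mul_assoc]
        _ = _ := by rw [hA.isIdempotentElem.eq]
    rw [hd, diagonal_mul_diagonal] at h2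
    have h3 := congrFun (diagonal_injective h2) i
    have h4 : hH.eigenvalues i * hH.eigenvalues i = hH.eigenvalues i := by
      have : ((hH.eigenvalues i : ℝ) : ℂ) * (hH.eigenvalues i : ℝ) = (hH.eigenvalues i : ℝ) := h3
      exact_mod_cast this
    rcases eq_or_ne (hH.eigenvalues i) 0 with h | h
    · exact .inl h
    · exact .inr (mul_left_cancel₀ h (by rw [h4, mul_one]))
  have hd' : Uᴴ * A * U =
      diagonal (fun i => if i ∈ Finset.univ.filter (fun i => hH.eigenvalues i = 1) then 1 else 0) := by
    rw [hd]
    congr 1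
    ext i
    rcases hsq i with h | h <;> simp [h]
  refine ⟨U, hU, _, hd', ?_⟩
  calc A.trace = (Uᴴ * A * U).trace := by
        rw [Matrix.mul_assoc, trace_mul_comm, Matrix.mul_assoc, hU', Matrix.mul_one]
    _ = _ := by rw [hd', trace_diagonal]; simp

/-- In an eigenbasis of `A` the form is a sum of `|z i|²` over `k` coordinates. The Gaussian law is
unchanged by the change of basis, and each of these coordinates contributes a factor `1 / (1 + t)`.
-/
theorem lintegral_exp_neg_quadForm {n k : ℕ} {A : Matrix (Fin n) (Fin n) ℂ}
    (hA : IsStarProjection A) (hk : A.trace = k) {t : ℝ} (ht : 0 ≤ t) :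
    ∫⁻ z, ENNReal.ofReal (Real.exp (-(t * quadForm A z))) ∂stdComplexNormalVec n =
      ENNReal.ofReal ((1 / (1 + t)) ^ k) := by
  obtain ⟨U, hU, s, hd, hs⟩ := IsStarProjection.exists_unitary_diagonal hA
  have hks : k = s.card := by rw [hs] at hk; exact_mod_cast hk.symm
  rw [← (measurePreserving_mulVec_stdComplexNormalVec hU).lintegral_comp
    (by have := measurable_quadForm A; fun_prop)]
  simp_rw [← quadForm_conjTranspose_mul_mul, hd]
  have : ∀ z : Fin n → ℂ, ENNReal.ofReal (Real.exp
      (-(t * quadForm (diagonal (fun i => if i ∈ s then 1 else 0)) z))) =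
      ∏ i, ENNReal.ofReal (Real.exp (-((if i ∈ s then t else 0) * ‖z i‖ ^ 2))) := by
    intro z
    rw [← ENNReal.ofReal_prod_of_nonneg (fun _ _ => by positivity), ← Real.exp_sum, quadForm]
    simp only [dotProduct, mulVec_diagonal, Complex.re_sum, Finset.mul_sum,
      ← Finset.sum_neg_distrib]
    congr 3 with i
    split_ifs <;> simp [← Complex.normSq_eq_norm_sq, Complex.normSq_apply]
  simp_rw [this]
  rw [stdComplexNormalVec, lintegral_fin_prod_eq_prod _
    (fun i w => ENNReal.ofReal (Real.exp (-((if i ∈ s then t else 0) * ‖w‖ ^ 2)))) (by fun_prop)]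
  have : ∀ i, ∫⁻ w : ℂ, ENNReal.ofReal (Real.exp (-((if i ∈ s then t else 0) * ‖w‖ ^ 2)))
      ∂stdComplexNormal = if i ∈ s then ENNReal.ofReal (1 / (1 + t)) else 1 := by
    intro i
    rw [lintegral_exp_neg_mul_stdComplexNormal (by split_ifs <;> simp [ht])]
    split_ifs <;> simp
  simp_rw [this]
  rw [Finset.prod_ite_mem, Finset.univ_inter, Finset.prod_const,
    ← ENNReal.ofReal_pow (by positivity), hks]

theorem lintegral_inv_quadForm {n k : ℕ} {A : Matrix (Fin n) (Fin n) ℂ}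
    (hA : IsStarProjection A) (hk : A.trace = k) (hk2 : 2 ≤ k) :
    ∫⁻ z, (ENNReal.ofReal (quadForm A z))⁻¹ ∂stdComplexNormalVec n =
      ENNReal.ofReal (1 / (k - 1)) := by
  simp_rw [fun z => inv_ofReal_eq_lintegral_exp (quadForm_nonneg hA z)]
  rw [lintegral_lintegral_swap
    (by have := measurable_quadForm A; simp only [Function.uncurry_def]; fun_prop),
    ← lintegral_one_add_inv_pow hk2]
  exact setLIntegral_congr_fun measurableSet_Ioi fun t ht =>
    lintegral_exp_neg_quadForm hA hk (le_of_lt ht)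

/-! ### Unitaries with prescribed action, and row projections. -/

/-- A unitary that sends `a` to `b` and fixes the orthogonal complement of `a - b`. -/
theorem exists_unitary_mulVec_eq {n : ℕ} {a b : Fin n → ℂ} (hab : star a ⬝ᵥ a = star b ⬝ᵥ b) :
    ∃ U : Matrix (Fin n) (Fin n) ℂ, Uᴴ * U = 1 ∧ U *ᵥ a = b ∧
      ∀ c, star (a - b) ⬝ᵥ c = 0 → U *ᵥ c = c := by
  set w := a - b with hw
  by_cases h0 : w = 0
  · exact ⟨1, by simp, by simp [sub_eq_zero.1 h0], by simp⟩
  -- The unitary is a complex Householder map `1 - d⁻¹ w wᴴ`. Equality of norms gives `‖w‖² = d +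
  -- star d`, which is exactly the unitarity condition; `d` need not be real.
  set d := star w ⬝ᵥ a with hd
  have hww : star w ⬝ᵥ w = d + star d := by
    have : star d = star a ⬝ᵥ w := by rw [hd, star_dotProduct, star_star]
    rw [this, hd, hw]
    simp only [star_sub, sub_dotProduct, dotProduct_sub]
    rw [hab]; ring
  have hd0 : d ≠ 0 := by
    intro h
    rw [h] at hww
    rw [star_zero, add_zero, dotProduct_star_self_eq_zero] at hww
    exact h0 hww
  have hd0' : (starRingEnd ℂ) d ≠ 0 := star_ne_zero.2 hd0
  have hmul : ∀ c, (1 - d⁻¹ • vecMulVec w (star w)) *ᵥ c = c - (d⁻¹ * (star w ⬝ᵥ c)) • w := by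
    intro c
    rw [sub_mulVec, one_mulVec, smul_mulVec, vecMulVec_mulVec]
    ext i; simp; ring
  refine ⟨1 - d⁻¹ • vecMulVec w (star w), ?_, ?_, ?_⟩
  · rw [conjTranspose_sub, conjTranspose_one, conjTranspose_smul, conjTranspose_vecMulVec,
      star_star, sub_mul, mul_sub, mul_sub, Matrix.one_mul, Matrix.one_mul, Matrix.mul_one,
      Matrix.smul_mul, Matrix.mul_smul, vecMulVec_mul_vecMulVec, hww]
    ext i j
    simp [vecMulVec_apply]
    field_simp
    ring
  · rw [hmul, ← hd, inv_mul_cancel₀ hd0, one_smul, hw, sub_sub_cancel]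
  · intro c hc
    rw [hmul, hc, mul_zero, zero_smul, sub_zero]

theorem isUnit_mul_conjTranspose_of_rank_eq {m n : ℕ} {Φ : Matrix (Fin m) (Fin n) ℂ}
    (h : Φ.rank = m) : IsUnit (Φ * Φᴴ) := by
  rw [← linearIndependent_rows_iff_isUnit, linearIndependent_iff_card_eq_finrank_span]
  have := rank_self_mul_conjTranspose Φ
  rw [rank_eq_finrank_span_row, h] at this
  simpa [Set.finrank] using this.symm

theorem isStarProjection_rowProjection {m n : ℕ} {Φ : Matrix (Fin m) (Fin n) ℂ}
    (h : IsUnit (Φ * Φᴴ)) : IsStarProjection (rowProjection Φ) := by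
  rw [isUnit_iff_isUnit_det] at h
  refine ⟨?_, ?_⟩
  · unfold IsIdempotentElem rowProjection
    calc _ = Φᴴ * (Φ * Φᴴ)⁻¹ * (Φ * Φᴴ * (Φ * Φᴴ)⁻¹) * Φ := by simp only [Matrix.mul_assoc]
      _ = _ := by rw [mul_nonsing_inv _ h, Matrix.mul_one]
  · change (rowProjection Φ)ᴴ = rowProjection Φ
    unfold rowProjection
    rw [conjTranspose_mul, conjTranspose_mul, conjTranspose_nonsing_inv, conjTranspose_mul,
      conjTranspose_conjTranspose, Matrix.mul_assoc]

theorem trace_rowProjection {m n : ℕ} {Φ : Matrix (Fin m) (Fin n) ℂ}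
    (h : IsUnit (Φ * Φᴴ)) : (rowProjection Φ).trace = m := by
  rw [isUnit_iff_isUnit_det] at h
  unfold rowProjection
  rw [trace_mul_comm, ← Matrix.mul_assoc, mul_nonsing_inv _ h]
  simp

theorem rowProjection_mul_unitary {m n : ℕ} (Φ : Matrix (Fin m) (Fin n) ℂ)
    {U : Matrix (Fin n) (Fin n) ℂ} (hU : U * Uᴴ = 1) :
    rowProjection (Φ * U) = Uᴴ * rowProjection Φ * U := by
  unfold rowProjection
  have : Φ * U * (Φ * U)ᴴ = Φ * Φᴴ := by
    rw [conjTranspose_mul, Matrix.mul_assoc, ← Matrix.mul_assoc U, hU, Matrix.one_mul]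
  rw [this, conjTranspose_mul]
  simp only [Matrix.mul_assoc]

/-! ### Residual projections. -/

/-- The projection onto the orthogonal complement, inside the range of the projection `Q`, of the
columns of `Q * H`. -/
noncomputable def residualProjection {n q : ℕ} (Q : Matrix (Fin n) (Fin n) ℂ)
    (H : Matrix (Fin n) (Fin q) ℂ) : Matrix (Fin n) (Fin n) ℂ :=
  Q - Q * H * (Hᴴ * Q * H)⁻¹ * Hᴴ * Q

section residual

variable {n q : ℕ} {Q : Matrix (Fin n) (Fin n) ℂ} {H : Matrix (Fin n) (Fin q) ℂ}

theorem conjTranspose_mul_residualProjection (h : IsUnit (Hᴴ * Q * H)) :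
    Hᴴ * residualProjection Q H = 0 := by
  rw [isUnit_iff_isUnit_det] at h
  unfold residualProjection
  rw [Matrix.mul_sub, sub_eq_zero]
  calc Hᴴ * Q = (Hᴴ * Q * H * (Hᴴ * Q * H)⁻¹) * Hᴴ * Q := by
        rw [mul_nonsing_inv _ h, Matrix.one_mul]
    _ = _ := by simp only [Matrix.mul_assoc]

theorem isStarProjection_residualProjection (hQ : IsStarProjection Q)
    (h : IsUnit (Hᴴ * Q * H)) : IsStarProjection (residualProjection Q H) := by
  have h1 : Qᴴ = Q := hQ.isSelfAdjoint
  have h2 : Q * Q = Q := hQ.isIdempotentElem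
  have hsa : (residualProjection Q H)ᴴ = residualProjection Q H := by
    unfold residualProjection
    simp only [conjTranspose_sub, conjTranspose_mul, conjTranspose_nonsing_inv,
      conjTranspose_conjTranspose, h1, Matrix.mul_assoc]
  refine ⟨?_, hsa⟩
  have h3 : Q * residualProjection Q H = residualProjection Q H := by
    unfold residualProjection
    rw [mul_sub, h2]
    simp only [← Matrix.mul_assoc, h2]
  have h4 := conjTranspose_mul_residualProjection h
  unfold IsIdempotentElem
  conv_lhs => lhs; unfold residualProjection
  rw [sub_mul, h3, Matrix.mul_assoc (Q * H * (Hᴴ * Q * H)⁻¹ * Hᴴ), h3, Matrix.mul_assoc _ Hᴴ, h4,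
    Matrix.mul_zero, sub_zero]

theorem residualProjection_mul (hQ : IsStarProjection Q) (h : IsUnit (Hᴴ * Q * H)) :
    residualProjection Q H * H = 0 := by
  have h1 : (residualProjection Q H)ᴴ = residualProjection Q H :=
    (isStarProjection_residualProjection hQ h).isSelfAdjoint
  have := congrArg conjTranspose (conjTranspose_mul_residualProjection h)
  rwa [conjTranspose_mul, h1, conjTranspose_conjTranspose, conjTranspose_zero] at this

theorem trace_residualProjection (hQ : IsStarProjection Q) (h : IsUnit (Hᴴ * Q * H)) :
    (residualProjection Q H).trace = Q.trace - q := by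
  rw [isUnit_iff_isUnit_det] at h
  have h2 : Q * Q = Q := hQ.isIdempotentElem
  unfold residualProjection
  rw [trace_sub, trace_mul_comm]
  have : Q * (Q * H * (Hᴴ * Q * H)⁻¹ * Hᴴ) = (Q * H * (Hᴴ * Q * H)⁻¹) * Hᴴ := by
    simp only [← Matrix.mul_assoc, h2]
  rw [this, trace_mul_comm, ← Matrix.mul_assoc, ← Matrix.mul_assoc, mul_nonsing_inv _ h]
  simp

theorem residualProjection_conj {U : Matrix (Fin n) (Fin n) ℂ} (hUH : U * H = H) :
    residualProjection (Uᴴ * Q * U) H = Uᴴ * residualProjection Q H * U := by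
  have h' : Hᴴ * Uᴴ = Hᴴ := by rw [← conjTranspose_mul, hUH]
  have h1 : Uᴴ * Q * U * H = Uᴴ * Q * H := by rw [Matrix.mul_assoc, hUH]
  have h2 : Hᴴ * (Uᴴ * Q * U) = Hᴴ * Q * U := by simp only [← Matrix.mul_assoc, h']
  unfold residualProjection
  rw [h2, h1, Matrix.mul_assoc _ Hᴴ, h2, Matrix.mul_assoc (Hᴴ * Q), hUH]
  simp only [Matrix.mul_sub, Matrix.sub_mul, Matrix.mul_assoc]

/-- `residualProjection 1 H` differs from the identity by a matrix whose columns are combinations of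
those of `H`, and `residualProjection Q H` kills them. -/
theorem residualProjection_mul_residualProjection_one (hQ : IsStarProjection Q)
    (h : IsUnit (Hᴴ * Q * H)) :
    residualProjection Q H * residualProjection 1 H = residualProjection Q H := by
  conv_lhs => rhs; unfold residualProjection
  rw [mul_sub, Matrix.mul_one, Matrix.one_mul, Matrix.mul_one, Matrix.mul_one, ← Matrix.mul_assoc,
    ← Matrix.mul_assoc, residualProjection_mul hQ h]
  simp

end residual

/-! ### Schur complement of the Gram matrix with respect to the first column. -/

section firstColumn

variable {n q : ℕ} (G : Matrix (Fin n) (Fin (q + 1)) ℂ)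

/-- The matrix without its first column. -/
def tailCols : Matrix (Fin n) (Fin q) ℂ := G.submatrix id Fin.succ

theorem mulVec_eq_tailCols (u : Fin (q + 1) → ℂ) :
    G *ᵥ u = u 0 • G.col 0 + tailCols G *ᵥ fun j => u j.succ := by
  ext i
  simp [mulVec, dotProduct, Fin.sum_univ_succ, tailCols, mul_comm]

theorem conjTranspose_mulVec_succ (z : Fin n → ℂ) (j : Fin q) :
    (Gᴴ *ᵥ z) j.succ = ((tailCols G)ᴴ *ᵥ z) j := rfl

theorem conjTranspose_mulVec_zero (z : Fin n → ℂ) :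
    (Gᴴ *ᵥ z) 0 = star (G.col 0) ⬝ᵥ z := rfl

variable {G} {Q : Matrix (Fin n) (Fin n) ℂ}

/-- Block elimination: the tail of `y` holds the negated least-squares coefficients of `Q g` on the
columns of `Q H`, so `Q G y` is the residual of `g`, orthogonal to `H`. -/
theorem exists_gram_mulVec_eq_single (hQ : IsStarProjection Q)
    (h : IsUnit ((tailCols G)ᴴ * Q * tailCols G)) :
    ∃ y : Fin (q + 1) → ℂ, y 0 = 1 ∧ (Gᴴ * Q * G) *ᵥ y =
      Pi.single 0 (quadForm (residualProjection Q (tailCols G)) (G.col 0) : ℂ) := by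
  set H := tailCols G with hH
  set c : Fin q → ℂ := -(((Hᴴ * Q * H)⁻¹ * Hᴴ * Q) *ᵥ G.col 0) with hc
  refine ⟨Fin.cons 1 c, rfl, ?_⟩
  have h1 : (Q * G) *ᵥ (Fin.cons 1 c : Fin (q + 1) → ℂ) = residualProjection Q H *ᵥ G.col 0 := by
    rw [← mulVec_mulVec, mulVec_eq_tailCols]
    simp only [Fin.cons_zero, Fin.cons_succ, one_smul]
    rw [mulVec_add, hc, mulVec_neg, mulVec_neg, mulVec_mulVec, mulVec_mulVec, ← sub_eq_add_neg,
      ← sub_mulVec, residualProjection]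
    simp only [Matrix.mul_assoc, hH]
  rw [Matrix.mul_assoc, ← mulVec_mulVec, h1]
  ext j
  refine Fin.cases ?_ (fun j => ?_) j
  · rw [conjTranspose_mulVec_zero, Pi.single_eq_same,
      coe_quadForm (isStarProjection_residualProjection hQ h)]
  · rw [conjTranspose_mulVec_succ, mulVec_mulVec, ← hH, conjTranspose_mul_residualProjection h]
    simp

theorem isUnit_gram_of_tailCols (hQ : IsStarProjection Q)
    (h : IsUnit ((tailCols G)ᴴ * Q * tailCols G))
    (hg : quadForm (residualProjection Q (tailCols G)) (G.col 0) ≠ 0) :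
    IsUnit (Gᴴ * Q * G) := by
  obtain ⟨y, -, hy⟩ := exists_gram_mulVec_eq_single hQ h
  have hQ1 : Qᴴ = Q := hQ.isSelfAdjoint
  rw [← mulVec_injective_iff_isUnit]
  refine (injective_iff_map_eq_zero (Matrix.mulVecLin (Gᴴ * Q * G))).2 fun u hu => ?_
  rw [mulVecLin_apply] at hu
  have h0 : u 0 = 0 := by
    -- The Gram matrix is Hermitian, so a kernel vector `u` is orthogonal to its image, which
    -- contains a nonzero multiple of the first basis vector.
    have : star ((Gᴴ * Q * G) *ᵥ y) ⬝ᵥ u = 0 := by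
      rw [star_mulVec]
      simp only [conjTranspose_mul, conjTranspose_conjTranspose, hQ1]
      rw [← Matrix.mul_assoc, ← dotProduct_mulVec, hu, dotProduct_zero]
    rw [hy, ← Pi.single_star, single_dotProduct] at this
    simpa [hg] using this
  have ht : (fun j : Fin q => u j.succ) = 0 := by
    have hinj := mulVec_injective_iff_isUnit.2 h
    apply hinj
    rw [mulVec_zero]
    ext j
    have := congrFun hu j.succ
    rw [Matrix.mul_assoc, ← mulVec_mulVec, conjTranspose_mulVec_succ, ← mulVec_mulVec,
      mulVec_eq_tailCols, h0, zero_smul, zero_add] at this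
    rw [Matrix.mul_assoc, ← mulVec_mulVec, ← mulVec_mulVec]
    exact this
  ext j
  exact Fin.cases h0 (fun j => congrFun ht j) j

theorem inv_gram_zero_zero (hQ : IsStarProjection Q)
    (h : IsUnit ((tailCols G)ᴴ * Q * tailCols G)) (hB : IsUnit (Gᴴ * Q * G)) :
    quadForm (residualProjection Q (tailCols G)) (G.col 0) ≠ 0 ∧ (Gᴴ * Q * G)⁻¹ 0 0 =
      ((quadForm (residualProjection Q (tailCols G)) (G.col 0))⁻¹ : ℝ) := by
  obtain ⟨y, hy0, hy⟩ := exists_gram_mulVec_eq_single hQ h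
  rw [isUnit_iff_isUnit_det] at hB
  set r := quadForm (residualProjection Q (tailCols G)) (G.col 0)
  have h1 : y = (Gᴴ * Q * G)⁻¹ *ᵥ Pi.single 0 (r : ℂ) := by
    rw [← hy, mulVec_mulVec, nonsing_inv_mul _ hB, one_mulVec]
  have h2 := congrFun h1 0
  rw [hy0, mulVec_single] at h2
  simp at h2
  have hr : r ≠ 0 := by rintro h; simp [h] at h2
  refine ⟨hr, ?_⟩
  have hr' : (r : ℂ) ≠ 0 := by exact_mod_cast hr
  push_cast
  field_simp
  rw [h2]

theorem isUnit_gram_iff {n p : ℕ} (G : Matrix (Fin n) (Fin p) ℂ) :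
    IsUnit (Gᴴ * G) ↔ Function.Injective G.mulVec := by
  rw [← mulVec_injective_iff_isUnit]
  constructor
  · intro h u v huv
    exact h (by simp only [← mulVec_mulVec, huv])
  · intro h
    refine (injective_iff_map_eq_zero (Matrix.mulVecLin (Gᴴ * G))).2 fun u hu => ?_
    rw [mulVecLin_apply, conjTranspose_mul_self_mulVec_eq_zero] at hu
    exact h (by rw [hu, mulVec_zero])

theorem isUnit_gram_tailCols (h : IsUnit (Gᴴ * G)) : IsUnit ((tailCols G)ᴴ * tailCols G) := by
  rw [isUnit_gram_iff] at *
  intro u v huv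
  have := @h (Fin.cons 0 u) (Fin.cons 0 v) (by
    simp only [mulVec_eq_tailCols, Fin.cons_zero, zero_smul, zero_add, Fin.cons_succ]; exact huv)
  exact (Fin.cons_injective2 this).2

end firstColumn

/-! ### Entrywise measurability of matrix-valued maps. -/

section measurability

variable {X : Type*} [MeasurableSpace X] {n k l : ℕ}

/-- All entries of the matrix-valued function `A` are measurable. -/
def EntryMeasurable (A : X → Matrix (Fin k) (Fin l) ℂ) : Prop :=
  ∀ i j, Measurable fun x => A x i j

theorem EntryMeasurable.mul {A : X → Matrix (Fin k) (Fin n) ℂ} {B : X → Matrix (Fin n) (Fin l) ℂ}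
    (hA : EntryMeasurable A) (hB : EntryMeasurable B) : EntryMeasurable fun x => A x * B x := by
  intro i j
  simp only [mul_apply]
  exact Finset.measurable_fun_sum _ fun a _ => (hA i a).mul (hB a j)

theorem EntryMeasurable.conjTranspose {A : X → Matrix (Fin k) (Fin l) ℂ}
    (hA : EntryMeasurable A) : EntryMeasurable fun x => (A x)ᴴ := fun i j =>
  Complex.continuous_conj.measurable.comp (hA j i)

theorem EntryMeasurable.sub {A B : X → Matrix (Fin k) (Fin l) ℂ}
    (hA : EntryMeasurable A) (hB : EntryMeasurable B) : EntryMeasurable fun x => A x - B x :=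
  fun i j => (hA i j).sub (hB i j)

theorem entryMeasurable_const (A : Matrix (Fin k) (Fin l) ℂ) :
    EntryMeasurable fun _ : X => A := fun _ _ => measurable_const

theorem EntryMeasurable.det {A : X → Matrix (Fin k) (Fin k) ℂ} (hA : EntryMeasurable A) :
    Measurable fun x => (A x).det := by
  simp only [det_apply]
  exact Finset.measurable_fun_sum _ fun s _ =>
    (Finset.measurable_fun_prod _ fun i _ => hA _ _).const_smul (Equiv.Perm.sign s)

theorem EntryMeasurable.inv {A : X → Matrix (Fin k) (Fin k) ℂ} (hA : EntryMeasurable A) :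
    EntryMeasurable fun x => (A x)⁻¹ := by
  intro i j
  -- Adjugate over determinant: with the convention `0⁻¹ = 0` this is measurable everywhere,
  -- singular matrices included.
  simp only [inv_def, Ring.inverse_eq_inv', Matrix.smul_apply, smul_eq_mul, adjugate_apply]
  refine hA.det.inv.mul (EntryMeasurable.det fun a b => ?_)
  by_cases h : a = j
  · subst h; simp only [updateRow_self]; exact measurable_const
  · simp only [updateRow_ne h]; exact hA a b

theorem EntryMeasurable.quadForm {A : X → Matrix (Fin k) (Fin k) ℂ} (hA : EntryMeasurable A)
    {z : X → Fin k → ℂ} (hz : Measurable z) :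
    Measurable fun x => CompressedFisher.quadForm (A x) (z x) := by
  unfold CompressedFisher.quadForm
  simp only [dotProduct, mulVec]
  have hz' : ∀ i, Measurable fun x => z x i := fun i => (measurable_pi_apply i).comp hz
  refine Complex.measurable_re.comp (Finset.measurable_fun_sum _ fun i _ => Measurable.mul ?_ ?_)
  · exact Complex.continuous_conj.measurable.comp (hz' i)
  · exact Finset.measurable_fun_sum _ fun j _ => (hA i j).mul (hz' j)

theorem EntryMeasurable.comp {Y : Type*} [MeasurableSpace Y]
    {A : X → Matrix (Fin k) (Fin l) ℂ} (hA : EntryMeasurable A) {f : Y → X} (hf : Measurable f) :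
    EntryMeasurable fun y => A (f y) := fun i j => (hA i j).comp hf

theorem entryMeasurable_of : EntryMeasurable fun M : Fin k → Fin l → ℂ => Matrix.of M :=
  fun i j => (measurable_pi_apply j).comp (measurable_pi_apply i)

theorem entryMeasurable_rowProjection :
    EntryMeasurable fun M : Fin k → Fin l → ℂ => rowProjection (Matrix.of M) := by
  have h := entryMeasurable_of (k := k) (l := l)
  exact (h.conjTranspose.mul (h.mul h.conjTranspose).inv).mul h

theorem EntryMeasurable.residualProjection {Q : X → Matrix (Fin k) (Fin k) ℂ}
    (hQ : EntryMeasurable Q) (H : Matrix (Fin k) (Fin l) ℂ) :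
    EntryMeasurable fun x => residualProjection (Q x) H := by
  have h := entryMeasurable_const (X := X) H
  exact hQ.sub ((((hQ.mul h).mul ((h.conjTranspose.mul hQ).mul h).inv).mul h.conjTranspose).mul hQ)

end measurability

/-! ### Invariant laws and the mean of the inverse Gram matrix. -/

/-- A probability law on `m × n` matrices that is invariant under right multiplication by unitary
matrices and charges only matrices of full row rank. -/
structure IsInvariantFullRankLaw {m n : ℕ} (ν : Measure (Fin m → Fin n → ℂ)) : Prop where
  isProbabilityMeasure : IsProbabilityMeasure ν
  lintegral_mul : ∀ U : Matrix (Fin n) (Fin n) ℂ, U * Uᴴ = 1 →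
    ∀ f : Matrix (Fin m) (Fin n) ℂ → ENNReal,
      Measurable (fun M : Fin m → Fin n → ℂ => f (Matrix.of M)) →
      ∫⁻ M, f (Matrix.of M * U) ∂ν = ∫⁻ M, f (Matrix.of M) ∂ν
  rank_eq : ∀ᵐ M ∂ν, (Matrix.of M).rank = m

theorem quadForm_smul_vec {n : ℕ} (A : Matrix (Fin n) (Fin n) ℂ) (s : ℝ) (z : Fin n → ℂ) :
    quadForm A ((s : ℂ) • z) = s ^ 2 * quadForm A z := by
  unfold quadForm
  rw [mulVec_smul, dotProduct_smul, star_smul, smul_dotProduct, smul_smul]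
  simp only [smul_eq_mul]
  have : (s : ℂ) * star (s : ℂ) = ((s ^ 2 : ℝ) : ℂ) := by simp [sq]
  rw [this, Complex.re_ofReal_mul]

theorem quadForm_eq_star_dotProduct_self {n : ℕ} {A : Matrix (Fin n) (Fin n) ℂ}
    (hA : IsStarProjection A) (z : Fin n → ℂ) :
    (quadForm A z : ℂ) = star (A *ᵥ z) ⬝ᵥ (A *ᵥ z) := by
  rw [coe_quadForm hA, star_dotProduct_mulVec_of_isStarProjection hA]

section core

variable {m n : ℕ} {ν : Measure (Fin m → Fin n → ℂ)}

theorem IsInvariantFullRankLaw.ae_isStarProjection (hν : IsInvariantFullRankLaw ν) :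
    ∀ᵐ M ∂ν, IsStarProjection (rowProjection (Matrix.of M)) ∧
      (rowProjection (Matrix.of M)).trace = m := by
  filter_upwards [hν.rank_eq] with M hM
  have := isUnit_mul_conjTranspose_of_rank_eq hM
  exact ⟨isStarProjection_rowProjection this, trace_rowProjection this⟩

theorem isStarProjection_residualProjection_one {q : ℕ} {H : Matrix (Fin n) (Fin q) ℂ}
    (hH : IsUnit (Hᴴ * H)) : IsStarProjection (residualProjection 1 H) :=
  isStarProjection_residualProjection (by simp) (by simpa using hH)

theorem quadForm_residualProjection_eq {q : ℕ} {Q : Matrix (Fin n) (Fin n) ℂ}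
    {H : Matrix (Fin n) (Fin q) ℂ} (hQ : IsStarProjection Q)
    (h : IsUnit (Hᴴ * Q * H)) (z : Fin n → ℂ) :
    quadForm (residualProjection Q H) z =
      quadForm (residualProjection Q H) (residualProjection 1 H *ᵥ z) := by
  have hR := isStarProjection_residualProjection hQ h
  rw [quadForm_eq_of_isStarProjection hR, quadForm_eq_of_isStarProjection hR, mulVec_mulVec,
    residualProjection_mul_residualProjection_one hQ h]

/-- Only the component `T z` matters, and a unitary fixing `H` carries it to a multiple of `T g`.
Invariance then says that the mean reciprocal is inversely proportional to `quadForm T z`. -/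
theorem IsInvariantFullRankLaw.lintegral_inv_quadForm_mul_comm (hν : IsInvariantFullRankLaw ν)
    {q : ℕ} {H : Matrix (Fin n) (Fin q) ℂ} (hH : IsUnit (Hᴴ * H))
    (hHQ : ∀ᵐ M ∂ν, IsUnit (Hᴴ * rowProjection (Matrix.of M) * H)) {z g : Fin n → ℂ}
    (hz : quadForm (residualProjection 1 H) z ≠ 0)
    (hg : quadForm (residualProjection 1 H) g ≠ 0) :
    ∫⁻ M, (ENNReal.ofReal
        (quadForm (residualProjection (rowProjection (Matrix.of M)) H) z))⁻¹ ∂ν =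
      ENNReal.ofReal (quadForm (residualProjection 1 H) g) *
      (∫⁻ M, (ENNReal.ofReal
        (quadForm (residualProjection (rowProjection (Matrix.of M)) H) g))⁻¹ ∂ν) *
      (ENNReal.ofReal (quadForm (residualProjection 1 H) z))⁻¹ := by
  set T := residualProjection 1 H with hT
  have hTp : IsStarProjection T := isStarProjection_residualProjection_one hH
  have hz' : 0 < quadForm T z := (quadForm_nonneg hTp z).lt_of_ne' hz
  have hg' : 0 < quadForm T g := (quadForm_nonneg hTp g).lt_of_ne' hg
  have hHT : Hᴴ * T = 0 := conjTranspose_mul_residualProjection (by simpa using hH)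
  -- The scale that gives `T z` and `s • T g` equal norms, as a unitary between them requires.
  set s : ℝ := Real.sqrt (quadForm T z / quadForm T g) with hs
  have hs2 : s ^ 2 = quadForm T z / quadForm T g := Real.sq_sqrt (by positivity)
  obtain ⟨U, hU, hUz, hUfix⟩ := exists_unitary_mulVec_eq (a := T *ᵥ z) (b := (s : ℂ) • T *ᵥ g) (by
    rw [← quadForm_eq_star_dotProduct_self hTp, star_smul, smul_dotProduct, dotProduct_smul,
      ← quadForm_eq_star_dotProduct_self hTp, smul_smul]
    have : star (s : ℂ) * (s : ℂ) = ((s ^ 2 : ℝ) : ℂ) := by simp [sq]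
    rw [this, hs2, smul_eq_mul, ← Complex.ofReal_mul, div_mul_cancel₀ _ hg])
  have hU' : U * Uᴴ = 1 := mul_eq_one_comm.1 hU
  -- The columns of `H` are orthogonal to the range of `T`, hence to `T z - s • T g`.
  have hUH : U * H = H := by
    ext i j
    have hz0 : ∀ w, star (T *ᵥ w) ⬝ᵥ H.col j = 0 := by
      intro w
      have h1 : star (H.col j) ⬝ᵥ (T *ᵥ w) = 0 := by
        have h2 : (Hᴴ *ᵥ (T *ᵥ w)) j = 0 := by rw [mulVec_mulVec, hHT, zero_mulVec]; rfl
        exact h2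
      rw [star_dotProduct, h1, star_zero]
    have := hUfix (H.col j) (by
      rw [star_sub, sub_dotProduct, hz0, star_smul, smul_dotProduct, hz0]; simp)
    exact congrFun this i
  have hmeas : ∀ w : Fin n → ℂ, Measurable fun M : Fin m → Fin n → ℂ => (ENNReal.ofReal
      (quadForm (residualProjection (rowProjection (Matrix.of M)) H) w))⁻¹ := fun w =>
    ((entryMeasurable_rowProjection.residualProjection H).quadForm
      measurable_const).ennreal_ofReal.inv
  have key : ∀ᵐ M ∂ν, (ENNReal.ofReal (quadForm (residualProjection
      (rowProjection (Matrix.of M * U)) H) (T *ᵥ z)))⁻¹ =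
      (ENNReal.ofReal (quadForm T g) * (ENNReal.ofReal (quadForm T z))⁻¹) * (ENNReal.ofReal
        (quadForm (residualProjection (rowProjection (Matrix.of M)) H) g))⁻¹ := by
    filter_upwards [hν.ae_isStarProjection, hHQ] with M hM hMH
    rw [rowProjection_mul_unitary _ hU', residualProjection_conj hUH,
      quadForm_conjTranspose_mul_mul, hUz, quadForm_smul_vec,
      ← quadForm_residualProjection_eq hM.1 hMH, hs2, ENNReal.ofReal_mul (by positivity),
      ENNReal.mul_inv (.inr ENNReal.ofReal_ne_top) (.inl ENNReal.ofReal_ne_top),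
      ← ENNReal.ofReal_inv_of_pos (by positivity), ← ENNReal.ofReal_inv_of_pos hz',
      ← ENNReal.ofReal_mul (by positivity), inv_div, div_eq_mul_inv]
  calc _ = ∫⁻ M, (ENNReal.ofReal (quadForm (residualProjection
        (rowProjection (Matrix.of M)) H) (T *ᵥ z)))⁻¹ ∂ν := by
        refine lintegral_congr_ae ?_
        filter_upwards [hν.ae_isStarProjection, hHQ] with M hM hMH
        rw [quadForm_residualProjection_eq hM.1 hMH]
    _ = _ := (hν.lintegral_mul U hU' (fun Φ => (ENNReal.ofReal (quadForm (residualProjection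
        (rowProjection Φ) H) (T *ᵥ z)))⁻¹) (hmeas _)).symm
    _ = _ := lintegral_congr_ae key
    _ = _ := by rw [lintegral_const_mul _ (hmeas g)]; ring

/-- The double integral over `M` and an independent Gaussian `z` is evaluated in both orders: `M`
first gives the unknown `D` times the inverse moment for `T`, `z` first gives the inverse moment for
a projection of trace `m - q`. The bound `q + 2 ≤ m` makes the latter finite. -/
theorem IsInvariantFullRankLaw.lintegral_inv_quadForm (hν : IsInvariantFullRankLaw ν)
    {q : ℕ} (hq : q + 2 ≤ m) (hmn : m ≤ n) {H : Matrix (Fin n) (Fin q) ℂ}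
    (hH : IsUnit (Hᴴ * H))
    (hHQ : ∀ᵐ M ∂ν, IsUnit (Hᴴ * rowProjection (Matrix.of M) * H)) {g : Fin n → ℂ}
    (hg : quadForm (residualProjection 1 H) g ≠ 0) :
    ∫⁻ M, (ENNReal.ofReal
        (quadForm (residualProjection (rowProjection (Matrix.of M)) H) g))⁻¹ ∂ν =
      ENNReal.ofReal (((n : ℝ) - q - 1) / (m - q - 1) *
        (quadForm (residualProjection 1 H) g)⁻¹) := by
  have := hν.isProbabilityMeasure
  set T := residualProjection 1 H with hT
  have hTp : IsStarProjection T := isStarProjection_residualProjection_one hH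
  have hg' : 0 < quadForm T g := (quadForm_nonneg hTp g).lt_of_ne' hg
  have hTtr : T.trace = ((n - q : ℕ) : ℂ) := by
    rw [hT, trace_residualProjection (by simp) (by simpa using hH), Nat.cast_sub (by omega)]
    simp
  set D := ∫⁻ M, (ENNReal.ofReal
        (quadForm (residualProjection (rowProjection (Matrix.of M)) H) g))⁻¹ ∂ν with hD
  have hTmeas : Measurable fun z => (ENNReal.ofReal (quadForm T z))⁻¹ :=
    (measurable_quadForm T).ennreal_ofReal.inv
  have hT1 := CompressedFisher.lintegral_inv_quadForm hTp hTtr (by omega)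
  -- A finite mean of the reciprocal excludes zeros almost surely.
  have hTne : ∀ᵐ z ∂stdComplexNormalVec n, quadForm T z ≠ 0 := by
    have := ae_lt_top hTmeas (by rw [hT1]; exact ENNReal.ofReal_ne_top)
    filter_upwards [this] with z hz h0
    simp [h0] at hz
  have h1 : ∫⁻ z, ∫⁻ M, (ENNReal.ofReal
        (quadForm (residualProjection (rowProjection (Matrix.of M)) H) z))⁻¹ ∂ν
        ∂stdComplexNormalVec n = ENNReal.ofReal (quadForm T g) * D *
          ENNReal.ofReal (1 / ((n - q : ℕ) - 1)) := by
    rw [← hT1, ← lintegral_const_mul _ hTmeas]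
    refine lintegral_congr_ae ?_
    filter_upwards [hTne] with z hz
    exact hν.lintegral_inv_quadForm_mul_comm hH hHQ hz hg
  have h2 : ∫⁻ z, ∫⁻ M, (ENNReal.ofReal
        (quadForm (residualProjection (rowProjection (Matrix.of M)) H) z))⁻¹ ∂ν
        ∂stdComplexNormalVec n = ENNReal.ofReal (1 / ((m - q : ℕ) - 1)) := by
    rw [lintegral_lintegral_swap]
    · have : ∀ᵐ M ∂ν, ∫⁻ z, (ENNReal.ofReal
          (quadForm (residualProjection (rowProjection (Matrix.of M)) H) z))⁻¹
          ∂stdComplexNormalVec n = ENNReal.ofReal (1 / ((m - q : ℕ) - 1)) := by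
        filter_upwards [hν.ae_isStarProjection, hHQ] with M hM hMH
        refine CompressedFisher.lintegral_inv_quadForm
          (isStarProjection_residualProjection hM.1 hMH) ?_ (by omega)
        rw [trace_residualProjection hM.1 hMH, hM.2, Nat.cast_sub (by omega)]
      rw [lintegral_congr_ae this]
      simp
    · exact (((entryMeasurable_rowProjection.residualProjection H).comp
        measurable_snd).quadForm measurable_fst).ennreal_ofReal.inv.aemeasurable
  rw [h1] at h2
  have hn1 : (0 : ℝ) < n - q - 1 := by
    have : ((q + 2 : ℕ) : ℝ) ≤ n := by exact_mod_cast hq.trans hmn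
    push_cast at this; linarith
  have hm1 : (0 : ℝ) < m - q - 1 := by
    have : ((q + 2 : ℕ) : ℝ) ≤ m := by exact_mod_cast hq
    push_cast at this; linarith
  rw [Nat.cast_sub (by omega), Nat.cast_sub (by omega)] at h2
  have hfin : D ≠ ⊤ := by
    rintro h
    rw [h, ENNReal.mul_top (by simpa using hg'), ENNReal.top_mul (ENNReal.ofReal_pos.2 (one_div_pos.2 hn1)).ne'] at h2
    exact ENNReal.ofReal_ne_top h2.symm
  rw [← ENNReal.ofReal_toReal hfin, ← ENNReal.ofReal_mul hg'.le, ← ENNReal.ofReal_mul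
    (by positivity), ENNReal.ofReal_eq_ofReal_iff (by positivity) (by positivity)] at h2
  rw [← ENNReal.ofReal_toReal hfin]
  congr 1
  field_simp at h2 ⊢
  linarith

/-- Induction on the columns: once the tail Gram matrix is almost surely invertible, the reciprocal
Schur complement has finite mean, so the Schur complement is almost surely nonzero. -/
theorem IsInvariantFullRankLaw.ae_isUnit_gram (hν : IsInvariantFullRankLaw ν) (hmn : m ≤ n)
    {q : ℕ} (hq : q < m) (G : Matrix (Fin n) (Fin q) ℂ) (hG : IsUnit (Gᴴ * G)) :
    ∀ᵐ M ∂ν, IsUnit (Gᴴ * rowProjection (Matrix.of M) * G) := by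
  induction q with
  | zero => exact .of_forall fun M => isUnit_of_subsingleton _
  | succ q ih =>
    have hH := isUnit_gram_tailCols hG
    have hHQ := ih (by omega) (tailCols G) hH
    have hg := (inv_gram_zero_zero (Q := 1) (G := G) (by simp) (by simpa using hH)
      (by simpa using hG)).1
    have hint := hν.lintegral_inv_quadForm (by omega) hmn hH hHQ hg
    have hlt := ae_lt_top (μ := ν) (f := fun M => (ENNReal.ofReal (quadForm (residualProjection
      (rowProjection (Matrix.of M)) (tailCols G)) (G.col 0)))⁻¹) (((entryMeasurable_rowProjection.residualProjection
      (tailCols G)).quadForm measurable_const).ennreal_ofReal.inv)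
      (by rw [hint]; exact ENNReal.ofReal_ne_top)
    filter_upwards [hν.ae_isStarProjection, hHQ, hlt] with M hM hMH hMlt
    refine isUnit_gram_of_tailCols hM.1 hMH fun h0 => ?_
    simp [h0] at hMlt

theorem IsInvariantFullRankLaw.lintegral_inv_gram_zero_zero (hν : IsInvariantFullRankLaw ν)
    (hmn : m ≤ n) {q : ℕ} (hq : q + 1 < m) (G : Matrix (Fin n) (Fin (q + 1)) ℂ)
    (hG : IsUnit (Gᴴ * G)) :
    ∫⁻ M, ENNReal.ofReal ((Gᴴ * rowProjection (Matrix.of M) * G)⁻¹ 0 0).re ∂ν =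
      ENNReal.ofReal (((n : ℝ) - q - 1) / (m - q - 1) * ((Gᴴ * G)⁻¹ 0 0).re) := by
  have hH := isUnit_gram_tailCols hG
  have hHQ := hν.ae_isUnit_gram hmn (by omega) (tailCols G) hH
  have hg := inv_gram_zero_zero (Q := 1) (G := G) (by simp) (by simpa using hH)
      (by simpa using hG)
  rw [Matrix.mul_one] at hg
  rw [hg.2, Complex.ofReal_re, ← hν.lintegral_inv_quadForm (by omega) hmn hH hHQ hg.1]
  refine lintegral_congr_ae ?_
  filter_upwards [hν.ae_isStarProjection, hHQ, hν.ae_isUnit_gram hmn hq G hG] with M hM hMH hMG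
  obtain ⟨h1, h2⟩ := inv_gram_zero_zero hM.1 hMH hMG
  have hpos := (quadForm_nonneg (isStarProjection_residualProjection hM.1 hMH)
    (G.col 0)).lt_of_ne' h1
  rw [h2, Complex.ofReal_re, ENNReal.ofReal_inv_of_pos hpos]

end core

/-! ### Polarization and the two means as quadratic forms. -/

section

theorem coe_quadForm_of_isHermitian {n : ℕ} {A : Matrix (Fin n) (Fin n) ℂ}
    (hA : A.IsHermitian) (z : Fin n → ℂ) : (quadForm A z : ℂ) = star z ⬝ᵥ A *ᵥ z := by
  have h : star (star z ⬝ᵥ A *ᵥ z) = star z ⬝ᵥ A *ᵥ z := by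
    rw [← star_dotProduct, star_mulVec, hA.eq, ← dotProduct_mulVec]
  exact Complex.conj_eq_iff_re.1 h

theorem apply_eq_polarization {n : ℕ} {A : Matrix (Fin n) (Fin n) ℂ} (hA : A.IsHermitian)
    (i j : Fin n) :
    A i j = (1 / 4 : ℂ) * ((quadForm A (Pi.single i 1 + Pi.single j 1) : ℂ) -
      (quadForm A (Pi.single i 1 - Pi.single j 1) : ℂ) -
      Complex.I * (quadForm A (Pi.single i 1 + Complex.I • Pi.single j 1) : ℂ) +
      Complex.I * (quadForm A (Pi.single i 1 - Complex.I • Pi.single j 1) : ℂ)) := by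
  simp only [coe_quadForm_of_isHermitian hA, star_add, star_sub, star_smul, mulVec_add,
    mulVec_sub, mulVec_smul, ← Pi.single_star, star_one, dotProduct_add, dotProduct_sub,
    add_dotProduct, sub_dotProduct, smul_dotProduct, dotProduct_smul, single_dotProduct,
    mulVec_single_one, col_apply, smul_eq_mul, one_mul, Complex.star_def, Complex.conj_I]
  linear_combination (A i j / 2 - A j i / 2) * Complex.I_sq

theorem hasMatrixExpectation_of_quadForm {Ω : Type*} [MeasurableSpace Ω] {P : Measure Ω} {k : ℕ}
    {A : Ω → Matrix (Fin k) (Fin k) ℂ} {B : Matrix (Fin k) (Fin k) ℂ}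
    (hA : ∀ ω, (A ω).IsHermitian) (hB : B.IsHermitian)
    (h : ∀ v, Integrable (fun ω => quadForm (A ω) v) P ∧ ∫ ω, quadForm (A ω) v ∂P = quadForm B v) :
    HasMatrixExpectation A P B := by
  intro i j
  have hi : ∀ v, Integrable (fun ω => (quadForm (A ω) v : ℂ)) P := fun v => (h v).1.ofReal
  have he : ∀ v, ∫ ω, (quadForm (A ω) v : ℂ) ∂P = quadForm B v := fun v => by
    rw [integral_complex_ofReal, (h v).2]
  simp_rw [fun ω => apply_eq_polarization (hA ω) i j]
  refine ⟨((((hi _).sub (hi _)).sub ((hi _).const_mul _)).add ((hi _).const_mul _)).const_mul _, ?_⟩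
  rw [integral_const_mul, integral_add, integral_sub, integral_sub, integral_const_mul,
    integral_const_mul, he, he, he, he, ← apply_eq_polarization hB]
  all_goals first
    | exact hi _
    | exact (hi _).const_mul _
    | exact (hi _).sub (hi _)
    | exact ((hi _).sub (hi _)).sub ((hi _).const_mul _)

theorem integrable_and_integral_eq_of_lintegral {Ω : Type*} [MeasurableSpace Ω] {P : Measure Ω}
    {f : Ω → ℝ} (hf : AEMeasurable f P) (h0 : ∀ᵐ ω ∂P, 0 ≤ f ω) {c : ℝ} (hc : 0 ≤ c)
    (h : ∫⁻ ω, ENNReal.ofReal (f ω) ∂P = ENNReal.ofReal c) :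
    Integrable f P ∧ ∫ ω, f ω ∂P = c := by
  refine ⟨(lintegral_ofReal_ne_top_iff_integrable hf.aestronglyMeasurable h0).1
    (by rw [h]; exact ENNReal.ofReal_ne_top), ?_⟩
  rw [integral_eq_lintegral_of_nonneg_ae h0 hf.aestronglyMeasurable, h, ENNReal.toReal_ofReal hc]

/-- Turns the value of a quadratic form at any vector into a diagonal entry of a conjugated matrix.
-/
theorem exists_unitary_mulVec_single {n : ℕ} (i : Fin n) (v : Fin n → ℂ) :
    ∃ U : Matrix (Fin n) (Fin n) ℂ, U * Uᴴ = 1 ∧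
      U *ᵥ ((Real.sqrt (star v ⬝ᵥ v).re : ℂ) • Pi.single i 1) = v := by
  obtain ⟨U, hU, h, -⟩ := exists_unitary_mulVec_eq
    (a := (Real.sqrt (star v ⬝ᵥ v).re : ℂ) • Pi.single i 1) (b := v) (by
      rw [star_smul, smul_dotProduct, dotProduct_smul, ← Pi.single_star, single_dotProduct,
        Pi.single_eq_same]
      apply Complex.ext
      · simp [Real.mul_self_sqrt (star_dotProduct_self_nonneg v)]
      · simp [star_dotProduct_self_im])
  exact ⟨U, mul_eq_one_comm.1 hU, h⟩

theorem quadForm_single {n : ℕ} (A : Matrix (Fin n) (Fin n) ℂ) (i : Fin n) :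
    quadForm A (Pi.single i 1) = (A i i).re := by
  simp [quadForm, col_apply]

theorem quadForm_eq_of_mulVec_single {n : ℕ} {A : Matrix (Fin n) (Fin n) ℂ} (v : Fin n → ℂ)
    {U : Matrix (Fin n) (Fin n) ℂ} {i : Fin n}
    (h : U *ᵥ ((Real.sqrt (star v ⬝ᵥ v).re : ℂ) • Pi.single i 1) = v) :
    quadForm A v = (star v ⬝ᵥ v).re * ((Uᴴ * A * U) i i).re := by
  conv_lhs => rw [← h]
  rw [← quadForm_conjTranspose_mul_mul, quadForm_smul_vec,
    Real.sq_sqrt (star_dotProduct_self_nonneg v), quadForm_single]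

variable {m n : ℕ} {ν : Measure (Fin m → Fin n → ℂ)}

/-- By invariance the mean is `‖g‖²` times the mean of any one diagonal entry; the diagonal entries
sum to the trace `m`. -/
theorem IsInvariantFullRankLaw.lintegral_quadForm (hν : IsInvariantFullRankLaw ν)
    (g : Fin n → ℂ) : ∫⁻ M, ENNReal.ofReal (quadForm (rowProjection (Matrix.of M)) g) ∂ν =
      ENNReal.ofReal ((m : ℝ) / n * (star g ⬝ᵥ g).re) := by
  have := hν.isProbabilityMeasure
  have hentry : ∀ i, Measurable fun M : Fin m → Fin n → ℂ =>
      ENNReal.ofReal (rowProjection (Matrix.of M) i i).re := fun i =>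
    (Complex.measurable_re.comp (entryMeasurable_rowProjection i i)).ennreal_ofReal
  have h1 : ∀ i, ∫⁻ M, ENNReal.ofReal (quadForm (rowProjection (Matrix.of M)) g) ∂ν =
      ENNReal.ofReal (star g ⬝ᵥ g).re *
        ∫⁻ M, ENNReal.ofReal (rowProjection (Matrix.of M) i i).re ∂ν := by
    intro i
    obtain ⟨U, hU, hUg⟩ := exists_unitary_mulVec_single i g
    simp_rw [quadForm_eq_of_mulVec_single g hUg, ENNReal.ofReal_mul (star_dotProduct_self_nonneg g),
      ← rowProjection_mul_unitary _ hU]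
    rw [lintegral_const_mul' _ _ ENNReal.ofReal_ne_top,
      hν.lintegral_mul U hU (fun Φ => ENNReal.ofReal (rowProjection Φ i i).re) (hentry i)]
  have h2 : ∑ i, ∫⁻ M, ENNReal.ofReal (rowProjection (Matrix.of M) i i).re ∂ν = m := by
    rw [← lintegral_finsetSum _ fun i _ => hentry i]
    have : ∀ᵐ M ∂ν, ∑ i, ENNReal.ofReal (rowProjection (Matrix.of M) i i).re = m := by
      filter_upwards [hν.ae_isStarProjection] with M hM
      rw [← ENNReal.ofReal_sum_of_nonneg fun i _ => by
        rw [← quadForm_single]; exact quadForm_nonneg hM.1 _]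
      have := congrArg Complex.re hM.2
      simp only [trace, diag_apply, Complex.re_sum, Complex.natCast_re] at this
      rw [this, ENNReal.ofReal_natCast]
    rw [lintegral_congr_ae this]
    simp
  rcases Nat.eq_zero_or_pos n with rfl | hn
  · simp [quadForm]
  have h3 : (n : ENNReal) * ∫⁻ M, ENNReal.ofReal (quadForm (rowProjection (Matrix.of M)) g) ∂ν =
      ENNReal.ofReal (star g ⬝ᵥ g).re * m := by
    rw [← h2, Finset.mul_sum, ← Finset.sum_congr rfl fun i _ => h1 i]
    simp
  have hn0 : (n : ENNReal) ≠ 0 := by exact_mod_cast hn.ne'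
  rw [← ENNReal.mul_right_inj hn0 (ENNReal.natCast_ne_top n), h3, ← ENNReal.ofReal_natCast n,
    ← ENNReal.ofReal_natCast m, ← ENNReal.ofReal_mul (star_dotProduct_self_nonneg g),
    ← ENNReal.ofReal_mul (by positivity)]
  congr 1
  field_simp

/-- Replacing `G` by `G * U` rotates `v` onto the first axis, where only the `(0, 0)` entry of the
inverse is seen. -/
theorem IsInvariantFullRankLaw.lintegral_quadForm_inv_gram (hν : IsInvariantFullRankLaw ν)
    (hmn : m ≤ n) {p : ℕ} (hp : p < m) (G : Matrix (Fin n) (Fin p) ℂ)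
    (hG : IsUnit (Gᴴ * G)) (v : Fin p → ℂ) :
    ∫⁻ M, ENNReal.ofReal (quadForm (Gᴴ * rowProjection (Matrix.of M) * G)⁻¹ v) ∂ν =
      ENNReal.ofReal (((n : ℝ) - p) / (m - p) * quadForm (Gᴴ * G)⁻¹ v) := by
  cases p with
  | zero => simp [quadForm]
  | succ q =>
    obtain ⟨U, hU, hUv⟩ := exists_unitary_mulVec_single 0 v
    have hU' : Uᴴ * U = 1 := mul_eq_one_comm.1 hU
    have hinv : ∀ X : Matrix (Fin (q + 1)) (Fin (q + 1)) ℂ, Uᴴ * X⁻¹ * U = (Uᴴ * X * U)⁻¹ := by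
      intro X
      rw [Matrix.mul_inv_rev, Matrix.mul_inv_rev, inv_eq_right_inv hU', inv_eq_right_inv hU,
        Matrix.mul_assoc]
    have hGU : ∀ Q : Matrix (Fin n) (Fin n) ℂ, Uᴴ * (Gᴴ * Q * G) * U = (G * U)ᴴ * Q * (G * U) := by
      intro Q
      rw [conjTranspose_mul]; simp only [Matrix.mul_assoc]
    have hGU1 : Uᴴ * (Gᴴ * G) * U = (G * U)ᴴ * (G * U) := by
      rw [conjTranspose_mul]; simp only [Matrix.mul_assoc]
    have hunit : IsUnit ((G * U)ᴴ * (G * U)) := by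
      rw [← hGU1]
      exact ((IsUnit.of_mul_eq_one _ hU').mul hG).mul (IsUnit.of_mul_eq_one _ hU)
    have hs := star_dotProduct_self_nonneg v
    simp_rw [quadForm_eq_of_mulVec_single v hUv, hinv, hGU, hGU1, ENNReal.ofReal_mul hs]
    rw [lintegral_const_mul' _ _ ENNReal.ofReal_ne_top,
      hν.lintegral_inv_gram_zero_zero hmn hp _ hunit, ← ENNReal.ofReal_mul hs]
    congr 1
    push_cast
    ring

end

/-! ### The admissible compressors have invariant laws of full rank. -/

section

theorem isUnit_mul_conjTranspose_iff_rank_eq {m n : ℕ} {Φ : Matrix (Fin m) (Fin n) ℂ} :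
    IsUnit (Φ * Φᴴ) ↔ Φ.rank = m := by
  refine ⟨fun h => ?_, isUnit_mul_conjTranspose_of_rank_eq⟩
  rw [← rank_self_mul_conjTranspose, rank_of_isUnit _ h, Fintype.card_fin]

theorem linearIndependent_iff_rank_of_eq {m n : ℕ} {M : Fin m → Fin n → ℂ} :
    LinearIndependent ℂ M ↔ (Matrix.of M).rank = m := by
  rw [linearIndependent_iff_card_eq_finrank_span, rank_eq_finrank_span_row, Fintype.card_fin,
    eq_comm]
  rfl

theorem measurableSet_rank_eq (m n : ℕ) :
    MeasurableSet {M : Fin m → Fin n → ℂ | (Matrix.of M).rank = m} := by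
  simp_rw [← isUnit_mul_conjTranspose_iff_rank_eq, isUnit_iff_isUnit_det, isUnit_iff_ne_zero]
  have h := entryMeasurable_of (k := m) (l := n)
  exact (measurableSet_eq_fun (h.mul h.conjTranspose).det measurable_const).compl

/-- Rows are added one at a time: fewer than `n` rows span a proper subspace, which is null for the
new row. -/
theorem ae_rank_eq_of_submodule_null {n : ℕ} (μ : Measure (Fin n → ℂ)) [SigmaFinite μ]
    (hμ : ∀ S : Submodule ℂ (Fin n → ℂ), S ≠ ⊤ → μ S = 0) {m : ℕ} (hm : m ≤ n) :
    ∀ᵐ M ∂Measure.pi fun _ : Fin m => μ, (Matrix.of M).rank = m := by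
  induction m with
  | zero => exact .of_forall fun M => Nat.le_zero.1 (rank_le_height _)
  | succ m ih =>
    have e := measurePreserving_piFinSuccAbove (fun _ : Fin (m + 1) => μ) 0
    have hset : MeasurableSet {x : (Fin n → ℂ) × (Fin m → Fin n → ℂ) | (Matrix.of
        ((MeasurableEquiv.piFinSuccAbove (fun _ => Fin n → ℂ) 0).symm x)).rank = m + 1} :=
      (measurableSet_rank_eq (m + 1) n).preimage (MeasurableEquiv.measurable _)
    have hprod : ∀ᵐ x ∂μ.prod (Measure.pi fun _ : Fin m => μ), (Matrix.of
        ((MeasurableEquiv.piFinSuccAbove (fun _ => Fin n → ℂ) 0).symm x)).rank = m + 1 := by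
      rw [Measure.ae_prod_iff_ae_ae hset,
        Measure.ae_ae_comm (p := fun a b => (Matrix.of ((MeasurableEquiv.piFinSuccAbove
          (fun _ => Fin n → ℂ) 0).symm (a, b))).rank = m + 1) hset]
      filter_upwards [ih (by omega)] with M hM
      have hspan : Submodule.span ℂ (Set.range M) ≠ ⊤ := by
        intro h
        have h1 := finrank_range_le_card (R := ℂ) M
        rw [Set.finrank, h, finrank_top, Module.finrank_fin_fun, Fintype.card_fin] at h1
        omega
      have : ∀ᵐ z ∂μ, z ∉ Submodule.span ℂ (Set.range M) := by
        rw [ae_iff]; simpa using hμ _ hspan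
      filter_upwards [this] with z hz
      rw [← linearIndependent_iff_rank_of_eq]
      have hcons : (MeasurableEquiv.piFinSuccAbove (fun _ : Fin (m + 1) => Fin n → ℂ) 0).symm
          (z, M) = Fin.cons z M := Fin.insertNth_zero' z M
      rw [hcons]
      exact linearIndependent_finCons.2 ⟨linearIndependent_iff_rank_of_eq.2 hM, hz⟩
    have := e.quasiMeasurePreserving.ae hprod
    filter_upwards [this] with M hM
    rwa [MeasurableEquiv.symm_apply_apply] at hM

theorem volume_submodule_eq_zero {n : ℕ} (S : Submodule ℂ (Fin n → ℂ)) (hS : S ≠ ⊤) :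
    (volume : Measure (Fin n → ℂ)) S = 0 :=
  Measure.addHaar_submodule volume (S.restrictScalars ℝ) (by simpa using hS)

theorem measurePreserving_mul_unitary {m n : ℕ} {μ : Measure (Fin n → ℂ)} [SigmaFinite μ]
    (hμ : ∀ U : Matrix (Fin n) (Fin n) ℂ, Uᴴ * U = 1 →
      MeasurePreserving (fun z : Fin n → ℂ => U *ᵥ z) μ μ)
    {U : Matrix (Fin n) (Fin n) ℂ} (hU : U * Uᴴ = 1) :
    MeasurePreserving (fun (M : Fin m → Fin n → ℂ) i j => (Matrix.of M * U) i j)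
      (Measure.pi fun _ => μ) (Measure.pi fun _ => μ) := by
  -- Right multiplication by `U` acts on each row, read as a column vector, by `Uᵀ`.
  have hT : (Uᵀ)ᴴ * Uᵀ = 1 := by
    have : (Uᵀ)ᴴ = (Uᴴ)ᵀ := rfl
    rw [this, ← transpose_mul, hU, transpose_one]
  have := measurePreserving_pi (fun _ : Fin m => μ) (fun _ : Fin m => μ) fun _ => hμ _ hT
  convert! this using 4 with M i j
  simp [mulVec, mul_apply, dotProduct, mul_comm]

theorem isInvariantFullRankLaw_of_measurePreserving {m n : ℕ} {ν : Measure (Fin m → Fin n → ℂ)}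
    [IsProbabilityMeasure ν] (hν : ∀ U : Matrix (Fin n) (Fin n) ℂ, U * Uᴴ = 1 →
      MeasurePreserving (fun (M : Fin m → Fin n → ℂ) i j => (Matrix.of M * U) i j) ν ν)
    (hr : ∀ᵐ M ∂ν, (Matrix.of M).rank = m) : IsInvariantFullRankLaw ν where
  isProbabilityMeasure := inferInstance
  lintegral_mul U hU _ hf := (hν U hU).lintegral_comp hf
  rank_eq := hr

theorem lintegral_comp_eq_lintegral_map {Ω : Type*} [MeasurableSpace Ω] {P : Measure Ω}
    {m n : ℕ} {Φ : Ω → Matrix (Fin m) (Fin n) ℂ} (hmeas : AEMeasurable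
    (fun ω (i : Fin m) (j : Fin n) => Φ ω i j) P) {f : Matrix (Fin m) (Fin n) ℂ → ENNReal}
    (hf : Measurable fun M : Fin m → Fin n → ℂ => f (Matrix.of M)) :
    ∫⁻ ω, f (Φ ω) ∂P = ∫⁻ M, f (Matrix.of M)
      ∂P.map fun ω (i : Fin m) (j : Fin n) => Φ ω i j := by
  rw [lintegral_map' hf.aemeasurable hmeas]
  rfl

variable {Ω : Type*} [MeasurableSpace Ω] {P : Measure Ω} [IsProbabilityMeasure P] {m n : ℕ}
  {Φ : Ω → Matrix (Fin m) (Fin n) ℂ}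

theorem IsIIDStdComplexNormal.hasLaw (h : IsIIDStdComplexNormal Φ P) :
    HasLaw (fun ω (i : Fin m) (j : Fin n) => Φ ω i j)
      (Measure.pi fun _ : Fin m => stdComplexNormalVec n) P := by
  have hm : ∀ ij : Fin m × Fin n, AEMeasurable (fun ω => Φ ω ij.1 ij.2) P :=
    fun ij => (h.1 ij.1 ij.2).aemeasurable
  have h1 := (iIndepFun_iff_map_fun_eq_pi_map hm).1 h.2
  simp_rw [fun ij : Fin m × Fin n => (h.1 ij.1 ij.2).map_eq] at h1
  refine ⟨aemeasurable_pi_lambda _ fun i => aemeasurable_pi_lambda _ fun j => hm (i, j), ?_⟩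
  -- Currying identifies the product over index pairs with the product over rows of products over
  -- entries.
  have h2 := Measure.infinitePi_map_curry (fun (_ : Fin m) (_ : Fin n) => stdComplexNormal)
  simp only [Measure.infinitePi_eq_pi] at h2
  unfold stdComplexNormalVec
  rw [← h2, ← h1, AEMeasurable.map_map_of_aemeasurable (by fun_prop) (by fun_prop)]
  rfl

theorem IsRandomCompressor.aemeasurable (h : IsRandomCompressor Φ P) :
    AEMeasurable (fun ω (i : Fin m) (j : Fin n) => Φ ω i j) P := by
  rcases h with h | ⟨g, -, h⟩ | ⟨h, -⟩
  · exact h.hasLaw.aemeasurable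
  · exact h.aemeasurable
  · exact (h 1 (one_mem _)).aemeasurable_snd

theorem IsRandomCompressor.isInvariantFullRankLaw (hmn : m ≤ n) (h : IsRandomCompressor Φ P) :
    IsInvariantFullRankLaw (P.map fun ω (i : Fin m) (j : Fin n) => Φ ω i j) := by
  have hmeas := h.aemeasurable
  have hprob := Measure.isProbabilityMeasure_map hmeas
  rcases h with h | ⟨g, hg, h⟩ | ⟨h, hr⟩
  · rw [h.hasLaw.map_eq] at hprob ⊢
    refine isInvariantFullRankLaw_of_measurePreserving (fun U hU => measurePreserving_mul_unitary
      (fun U hU => measurePreserving_mulVec_stdComplexNormalVec hU) hU) ?_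
    refine ae_rank_eq_of_submodule_null _ (fun S hS => ?_) hmn
    rw [stdComplexNormalVec_eq_withDensity]
    exact withDensity_absolutelyContinuous _ _ (volume_submodule_eq_zero S hS)
  · rw [h.map_eq] at hprob ⊢
    refine isInvariantFullRankLaw_of_measurePreserving (fun U hU =>
      MeasurePreserving.withDensity_of_comp_eq (measurePreserving_mul_unitary
        (fun U hU => measurePreserving_mulVec_volume hU) hU) hg fun M => ?_) ?_
    · congr 1
      change Matrix.of M * U * (Matrix.of M * U)ᴴ = _
      rw [conjTranspose_mul, Matrix.mul_assoc, ← Matrix.mul_assoc U, hU, Matrix.one_mul]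
    · exact withDensity_absolutelyContinuous _ _
        (ae_rank_eq_of_submodule_null _ volume_submodule_eq_zero hmn)
  · refine ⟨hprob, fun U hU f hf => ?_, ?_⟩
    · have hid := h U (mem_unitaryGroup_iff.2 hU)
      have hτ : Measurable fun (M : Fin m → Fin n → ℂ) (i : Fin m) (j : Fin n) =>
          (Matrix.of M * U) i j :=
        measurable_pi_lambda _ fun i => measurable_pi_lambda _ fun j =>
          (entryMeasurable_of.mul (entryMeasurable_const U)) i j
      rw [lintegral_map' (f := fun M => f (Matrix.of M * U)) (hf.comp hτ).aemeasurable hmeas,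
        ← hid.map_eq,
        lintegral_map' hf.aemeasurable hid.aemeasurable_fst]
      rfl
    · exact (ae_map_iff hmeas (measurableSet_rank_eq m n)).2 hr

/-! ### Fisher information before and after compression. -/

theorem quadForm_ofReal_smul {k : ℕ} (c : ℝ) (A : Matrix (Fin k) (Fin k) ℂ) (v : Fin k → ℂ) :
    quadForm ((c : ℂ) • A) v = c * quadForm A v := by
  rw [quadForm, smul_mulVec, dotProduct_smul, smul_eq_mul, Complex.re_ofReal_mul, quadForm]

theorem isHermitian_ofReal_smul {k : ℕ} (c : ℝ) {A : Matrix (Fin k) (Fin k) ℂ}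
    (hA : A.IsHermitian) : ((c : ℂ) • A).IsHermitian := by
  rw [IsHermitian, conjTranspose_smul, hA.eq, Complex.star_def, Complex.conj_ofReal]

theorem quadForm_nonneg_of_posSemidef {k : ℕ} {A : Matrix (Fin k) (Fin k) ℂ}
    (hA : A.PosSemidef) (v : Fin k → ℂ) : 0 ≤ quadForm A v :=
  (Complex.le_def.1 (hA.dotProduct_mulVec_nonneg v)).1

section main

variable {p : ℕ} {σ : ℝ} {x : (Fin p → ℝ) → (Fin n → ℂ)} {θ : Fin p → ℝ}

theorem fisherInfo_eq : fisherInfo σ x θ =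
    (((σ ^ 2)⁻¹ : ℝ) : ℂ) • ((jacobian x θ)ᴴ * jacobian x θ) := by
  simp [fisherInfo]

theorem compressedFisherInfo_eq (M : Matrix (Fin m) (Fin n) ℂ) : compressedFisherInfo σ x θ M =
    (((σ ^ 2)⁻¹ : ℝ) : ℂ) •
      ((rowProjection M * jacobian x θ)ᴴ * (rowProjection M * jacobian x θ)) := by
  simp [compressedFisherInfo]

theorem compressedFisherInfo_eq_of_isStarProjection {M : Matrix (Fin m) (Fin n) ℂ}
    (hM : IsStarProjection (rowProjection M)) : compressedFisherInfo σ x θ M =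
    (((σ ^ 2)⁻¹ : ℝ) : ℂ) • ((jacobian x θ)ᴴ * rowProjection M * jacobian x θ) := by
  have h1 : (rowProjection M)ᴴ = rowProjection M := hM.isSelfAdjoint
  have h2 : rowProjection M * rowProjection M = rowProjection M := hM.isIdempotentElem
  rw [compressedFisherInfo_eq, conjTranspose_mul, h1, Matrix.mul_assoc, ← Matrix.mul_assoc _ _
    (jacobian x θ), h2, ← Matrix.mul_assoc]

theorem inv_ofReal_smul {k : ℕ} {c : ℝ} (hc : c ≠ 0) (A : Matrix (Fin k) (Fin k) ℂ)
    (hA : IsUnit A) : (((c⁻¹ : ℝ) : ℂ) • A)⁻¹ = (c : ℂ) • A⁻¹ := by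
  rw [isUnit_iff_isUnit_det] at hA
  have hc' : (c : ℂ) ≠ 0 := by exact_mod_cast hc
  apply inv_eq_right_inv
  rw [Matrix.smul_mul, Matrix.mul_smul, mul_nonsing_inv _ hA, smul_smul]
  simp [hc']

/-- The form `Ĝᴴ Ĝ` gives this for every `M`, even rank-deficient, so the polarization argument
needs no exceptional set. -/
theorem posSemidef_compressedFisherInfo (M : Matrix (Fin m) (Fin n) ℂ) :
    (compressedFisherInfo σ x θ M).PosSemidef := by
  rw [compressedFisherInfo_eq]
  refine (posSemidef_conjTranspose_mul_self _).smul ?_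
  rw [Complex.zero_le_real]
  positivity

theorem posSemidef_fisherInfo : (fisherInfo σ x θ).PosSemidef := by
  rw [fisherInfo_eq]
  refine (posSemidef_conjTranspose_mul_self _).smul ?_
  rw [Complex.zero_le_real]
  positivity

theorem entryMeasurable_compressedFisherInfo : EntryMeasurable fun M : Fin m → Fin n → ℂ =>
    compressedFisherInfo σ x θ (Matrix.of M) := by
  intro i j
  simp only [compressedFisherInfo, Matrix.smul_apply, smul_eq_mul]
  have h := (entryMeasurable_rowProjection (k := m) (l := n)).mul
    (entryMeasurable_const (jacobian x θ))
  exact ((h.conjTranspose.mul h) i j).const_mul _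

theorem isUnit_gram_jacobian (hσ : σ ≠ 0) (hJ : IsUnit (fisherInfo σ x θ)) :
    IsUnit ((jacobian x θ)ᴴ * jacobian x θ) := by
  have hc : IsUnit (((σ ^ 2)⁻¹ : ℝ) : ℂ) := by
    rw [isUnit_iff_ne_zero]; exact_mod_cast inv_ne_zero (pow_ne_zero 2 hσ)
  rw [fisherInfo_eq] at hJ
  rw [isUnit_iff_isUnit_det, det_smul] at hJ
  rw [isUnit_iff_isUnit_det]
  exact isUnit_of_mul_isUnit_right hJ

theorem IsRandomCompressor.ae_isStarProjection (hmn : m ≤ n) (hΦ : IsRandomCompressor Φ P) :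
    ∀ᵐ ω ∂P, IsStarProjection (rowProjection (Φ ω)) := by
  filter_upwards [ae_of_ae_map hΦ.aemeasurable
    (hΦ.isInvariantFullRankLaw hmn).ae_isStarProjection] with ω hω using hω.1

theorem IsRandomCompressor.hasMatrixExpectation (hmn : m ≤ n) (hΦ : IsRandomCompressor Φ P) :
    HasMatrixExpectation (fun ω => compressedFisherInfo σ x θ (Φ ω)) P
      (((m : ℂ) / (n : ℂ)) • fisherInfo σ x θ) := by
  have hc : (m : ℂ) / (n : ℂ) = ((m / n : ℝ) : ℂ) := by push_cast; rfl
  rw [hc]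
  refine hasMatrixExpectation_of_quadForm (fun ω => (posSemidef_compressedFisherInfo _).isHermitian)
    (isHermitian_ofReal_smul _ posSemidef_fisherInfo.isHermitian) fun v => ?_
  have hmeas : Measurable fun M : Fin m → Fin n → ℂ =>
      quadForm (compressedFisherInfo σ x θ (Matrix.of M)) v :=
    entryMeasurable_compressedFisherInfo.quadForm measurable_const
  refine integrable_and_integral_eq_of_lintegral
    (f := fun ω => quadForm (compressedFisherInfo σ x θ (Φ ω)) v)
    (hmeas.comp_aemeasurable hΦ.aemeasurable)
    (.of_forall fun ω => quadForm_nonneg_of_posSemidef (posSemidef_compressedFisherInfo _) v) ?_ ?_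
  · rw [quadForm_ofReal_smul]
    exact mul_nonneg (by positivity) (quadForm_nonneg_of_posSemidef posSemidef_fisherInfo v)
  have hσ : 0 ≤ (σ ^ 2)⁻¹ := by positivity
  have h1 : ∀ᵐ ω ∂P, ENNReal.ofReal (quadForm (compressedFisherInfo σ x θ (Φ ω)) v) =
      ENNReal.ofReal (σ ^ 2)⁻¹ *
        ENNReal.ofReal (quadForm (rowProjection (Φ ω)) (jacobian x θ *ᵥ v)) := by
    filter_upwards [hΦ.ae_isStarProjection hmn] with ω hω
    rw [compressedFisherInfo_eq_of_isStarProjection hω, quadForm_ofReal_smul,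
      quadForm_conjTranspose_mul_mul, ENNReal.ofReal_mul hσ]
  rw [lintegral_congr_ae h1, lintegral_const_mul' _ _ ENNReal.ofReal_ne_top,
    lintegral_comp_eq_lintegral_map hΦ.aemeasurable (f := fun M =>
      ENNReal.ofReal (quadForm (rowProjection M) (jacobian x θ *ᵥ v)))
      (entryMeasurable_rowProjection.quadForm measurable_const).ennreal_ofReal,
    (hΦ.isInvariantFullRankLaw hmn).lintegral_quadForm, ← ENNReal.ofReal_mul hσ]
  congr 1
  have : quadForm ((jacobian x θ)ᴴ * jacobian x θ) v =
      (star (jacobian x θ *ᵥ v) ⬝ᵥ (jacobian x θ *ᵥ v)).re := by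
    rw [quadForm, star_mulVec, ← mulVec_mulVec, dotProduct_mulVec]
  rw [quadForm_ofReal_smul, fisherInfo_eq, quadForm_ofReal_smul, this]
  ring

theorem IsRandomCompressor.ae_isUnit_compressedFisherInfo (hmn : m ≤ n) (hpm : p < m)
    (hσ : σ ≠ 0) (hJ : IsUnit (fisherInfo σ x θ)) (hΦ : IsRandomCompressor Φ P) :
    ∀ᵐ ω ∂P, IsUnit ((jacobian x θ)ᴴ * rowProjection (Φ ω) * jacobian x θ) ∧
      IsUnit (compressedFisherInfo σ x θ (Φ ω)) := by
  filter_upwards [hΦ.ae_isStarProjection hmn, ae_of_ae_map hΦ.aemeasurable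
    ((hΦ.isInvariantFullRankLaw hmn).ae_isUnit_gram hmn hpm _ (isUnit_gram_jacobian hσ hJ))]
    with ω h1 h2
  refine ⟨h2, ?_⟩
  change IsUnit ((jacobian x θ)ᴴ * rowProjection (Φ ω) * jacobian x θ) at h2
  rw [compressedFisherInfo_eq_of_isStarProjection h1]
  have hc : IsUnit (((σ ^ 2)⁻¹ : ℝ) : ℂ) := by
    rw [isUnit_iff_ne_zero]; exact_mod_cast inv_ne_zero (pow_ne_zero 2 hσ)
  rw [isUnit_iff_isUnit_det, det_smul]
  exact (hc.pow _).mul ((isUnit_iff_isUnit_det _).1 h2)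

theorem IsRandomCompressor.hasMatrixExpectation_inv (hmn : m ≤ n) (hpm : p < m)
    (hσ : σ ≠ 0) (hJ : IsUnit (fisherInfo σ x θ)) (hΦ : IsRandomCompressor Φ P) :
    HasMatrixExpectation (fun ω => (compressedFisherInfo σ x θ (Φ ω))⁻¹) P
      ((((n : ℂ) - (p : ℂ)) / ((m : ℂ) - (p : ℂ))) • (fisherInfo σ x θ)⁻¹) := by
  have hc : ((n : ℂ) - (p : ℂ)) / ((m : ℂ) - (p : ℂ)) = (((n - p) / (m - p) : ℝ) : ℂ) := by
    push_cast; rfl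
  rw [hc]
  refine hasMatrixExpectation_of_quadForm
    (fun ω => (posSemidef_compressedFisherInfo _).inv.isHermitian)
    (isHermitian_ofReal_smul _ posSemidef_fisherInfo.inv.isHermitian) fun v => ?_
  have hmeas : Measurable fun M : Fin m → Fin n → ℂ =>
      quadForm (compressedFisherInfo σ x θ (Matrix.of M))⁻¹ v :=
    entryMeasurable_compressedFisherInfo.inv.quadForm measurable_const
  have hpm' : (p : ℝ) < m := by exact_mod_cast hpm
  have hmn' : (m : ℝ) ≤ n := by exact_mod_cast hmn
  refine integrable_and_integral_eq_of_lintegral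
    (f := fun ω => quadForm (compressedFisherInfo σ x θ (Φ ω))⁻¹ v)
    (hmeas.comp_aemeasurable hΦ.aemeasurable)
    (.of_forall fun ω =>
      quadForm_nonneg_of_posSemidef (posSemidef_compressedFisherInfo _).inv v) ?_ ?_
  · rw [quadForm_ofReal_smul]
    exact mul_nonneg (div_nonneg (by linarith) (by linarith))
      (quadForm_nonneg_of_posSemidef posSemidef_fisherInfo.inv v)
  have hσ2 : 0 ≤ σ ^ 2 := by positivity
  have hσ0 : σ ^ 2 ≠ 0 := pow_ne_zero 2 hσ
  have h1 : ∀ᵐ ω ∂P, ENNReal.ofReal (quadForm (compressedFisherInfo σ x θ (Φ ω))⁻¹ v) =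
      ENNReal.ofReal (σ ^ 2) * ENNReal.ofReal
        (quadForm ((jacobian x θ)ᴴ * rowProjection (Φ ω) * jacobian x θ)⁻¹ v) := by
    filter_upwards [hΦ.ae_isStarProjection hmn,
      hΦ.ae_isUnit_compressedFisherInfo hmn hpm hσ hJ] with ω hω hωu
    rw [compressedFisherInfo_eq_of_isStarProjection hω, inv_ofReal_smul hσ0 _ hωu.1,
      quadForm_ofReal_smul, ENNReal.ofReal_mul hσ2]
  have hG := entryMeasurable_const (X := Fin m → Fin n → ℂ) (jacobian x θ)
  rw [lintegral_congr_ae h1, lintegral_const_mul' _ _ ENNReal.ofReal_ne_top,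
    lintegral_comp_eq_lintegral_map hΦ.aemeasurable (f := fun M =>
      ENNReal.ofReal (quadForm ((jacobian x θ)ᴴ * rowProjection M * jacobian x θ)⁻¹ v))
      (((hG.conjTranspose.mul entryMeasurable_rowProjection).mul hG).inv.quadForm
        measurable_const).ennreal_ofReal,
    (hΦ.isInvariantFullRankLaw hmn).lintegral_quadForm_inv_gram hmn hpm _
      (isUnit_gram_jacobian hσ hJ), ← ENNReal.ofReal_mul hσ2]
  congr 1
  rw [quadForm_ofReal_smul, fisherInfo_eq, inv_ofReal_smul hσ0 _ (isUnit_gram_jacobian hσ hJ),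
    quadForm_ofReal_smul]
  ring

end main

end

end CompressedFisher

theorem mainTheorem6
    {Ω : Type*} [MeasurableSpace Ω] (P : Measure Ω) [IsProbabilityMeasure P]
    (m n p : ℕ) (hmn : m + p ≤ n) (σ : ℝ) (hσ : 0 < σ)
    (x : (Fin p → ℝ) → (Fin n → ℂ)) (θ : Fin p → ℝ)
    (hx : ∀ j, LineDifferentiableAt ℝ x θ (Pi.single j 1))
    (hJ : IsUnit (CompressedFisher.fisherInfo σ x θ))
    (Φ : Ω → Matrix (Fin m) (Fin n) ℂ) (hΦ : CompressedFisher.IsRandomCompressor Φ P) :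
    -- mean Fisher information after compression
    CompressedFisher.HasMatrixExpectation
      (fun ω => CompressedFisher.compressedFisherInfo σ x θ (Φ ω)) P
      (((m : ℂ) / (n : ℂ)) • CompressedFisher.fisherInfo σ x θ) ∧
    -- average loss of Fisher information
    CompressedFisher.fisherInfo σ x θ -
        CompressedFisher.matrixExpectation
          (fun ω => CompressedFisher.compressedFisherInfo σ x θ (Φ ω)) P =
      (((n : ℂ) - (m : ℂ)) / (n : ℂ)) • CompressedFisher.fisherInfo σ x θ ∧
    -- mean of the inverse, i.e. of the CRB matrix, after compression
    (p < m →
      (∀ᵐ ω ∂P, IsUnit (CompressedFisher.compressedFisherInfo σ x θ (Φ ω))) ∧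
      CompressedFisher.HasMatrixExpectation
        (fun ω => (CompressedFisher.compressedFisherInfo σ x θ (Φ ω))⁻¹) P
        ((((n : ℂ) - (p : ℂ)) / ((m : ℂ) - (p : ℂ))) •
          (CompressedFisher.fisherInfo σ x θ)⁻¹)) := by
  have hmn' : m ≤ n := by omega
  have h1 := hΦ.hasMatrixExpectation (σ := σ) (x := x) (θ := θ) hmn'
  refine ⟨h1, ?_, fun hpm => ⟨?_, hΦ.hasMatrixExpectation_inv hmn' hpm hσ.ne' hJ⟩⟩
  · have h2 : CompressedFisher.matrixExpectation
        (fun ω => CompressedFisher.compressedFisherInfo σ x θ (Φ ω)) P =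
        ((m : ℂ) / (n : ℂ)) • CompressedFisher.fisherInfo σ x θ := by
      ext i j
      exact (h1 i j).2
    rw [h2]
    -- For `n = 0` the division is degenerate, but then `p = 0` and the matrices are empty.
    rcases Nat.eq_zero_or_pos n with rfl | hn
    · obtain rfl : p = 0 := by omega
      exact Subsingleton.elim _ _
    · have hn' : (n : ℂ) ≠ 0 := by exact_mod_cast hn.ne'
      rw [sub_div, div_self hn', sub_smul, one_smul]
  · filter_upwards [hΦ.ae_isUnit_compressedFisherInfo hmn' hpm hσ.ne' hJ] with ω hω using hω.2
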